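/- **Theorem 4.** An instance of *Maximum Vertex-Disjoint Shortest Paths* on weighted directed graphs consists of a directed graph $G=(V,E)$ with $n$ vertices, an arc-length function $w\colon E\to\mathbb{Q}_{\ge 0}$, terminal pairs $(s_1,t_1),\dots,(s_k,t_k)$ of vertices with $s_i\ne t_i$ for each $i$, and an integer $p\ge 0$. A path is a sequence of distinct vertices in which consecutive vertices are joined by an arc, and its length is the sum of its arc lengths. A *solution* is a set $S\subseteq\{1,\dots,k\}$ with $|S|\ge p$ together with pairwise vertex-disjoint paths $(P_i)_{i\in S}$ (disjoint including their ends) such that each $P_i$ is a shortest path from $s_i$ to $t_i$ in $G$. The question is whether a solution exists. Let $\ell$ be the minimum total number of arcs of the paths in a solution if a solution exists, and $\ell=n$ otherwise. There is a deterministic algorithm that decides every instance correctly in $2^{O(\ell)}\cdot\mathrm{poly}(n)$ time; it is not given $\ell$. Here time is the number of steps of a random access machine on which additions (and, for indices and counters, subtractions) and comparisons of natural numbers and of arc lengths take one step each and which has no multiplication, and the terminal pairs are assumed to be pairwise distinct (so that $k\le n^2$). If terminal pairs may be repeated, the same algorithm takes $2^{O(\ell)}\cdot\mathrm{poly}(n+k)$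 time. -/

import Mathlib

open scoped NNRat

/-! ### The problem -/

/-- An instance of Maximum Vertex-Disjoint Shortest Paths on a weighted directed graph with
vertex set `{0, …, n - 1}`. The values of `w` outside the arc set are irrelevant: no notion below
looks at them, and they are not part of the input that an algorithm gets. -/
structure MVDSP where
  /-- number of vertices -/
  n : ℕ
  /-- the directed graph -/
  G : Digraph (Fin n)
  /-- arc lengths -/
  w : Fin n → Fin n → ℚ≥0
  /-- number of terminal pairs -/
  k : ℕ
  /-- the terminals `s i` -/
  s : Fin k → Fin n
  /-- the terminals `t i` -/
  t : Fin k → Fin n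
  s_ne_t : ∀ i, s i ≠ t i
  /-- how many pairs have to be connected -/
  p : ℕ

namespace MVDSP

variable (I : MVDSP)

/-- `P` is a path from `a` to `b`: a sequence of distinct vertices, consecutive ones joined by an
arc, with first vertex `a` and last vertex `b`. -/
def IsPath (a b : Fin I.n) (P : List (Fin I.n)) : Prop :=
  P.head? = some a ∧ P.getLast? = some b ∧ P.IsChain I.G.Adj ∧ P.Nodup

/-- The length of a path: the sum of the lengths of its arcs. -/
def pathLength (P : List (Fin I.n)) : ℚ≥0 :=
  (List.zipWith I.w P P.tail).sum

/-- `P` is a shortest path from `a` to `b`. -/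
def IsShortestPath (a b : Fin I.n) (P : List (Fin I.n)) : Prop :=
  I.IsPath a b P ∧ ∀ Q, I.IsPath a b Q → I.pathLength P ≤ I.pathLength Q

/-- `(P i)` for `i ∈ S` is a solution: at least `p` pairwise (completely) vertex-disjoint paths,
the `i`-th one a shortest path from `s i` to `t i`. The lists `P i` with `i ∉ S` play no role. -/
def IsSolution (S : Finset (Fin I.k)) (P : Fin I.k → List (Fin I.n)) : Prop :=
  I.p ≤ S.card ∧
  (∀ i ∈ S, I.IsShortestPath (I.s i) (I.t i) (P i)) ∧
  (∀ i ∈ S, ∀ j ∈ S, i ≠ j → (P i).Disjoint (P j))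

/-- The instance is a yes-instance. -/
def IsYes : Prop := ∃ S P, I.IsSolution S P

/-- The number of arcs in the paths `P i`, `i ∈ S`. -/
def numArcs (S : Finset (Fin I.k)) (P : Fin I.k → List (Fin I.n)) : ℕ :=
  ∑ i ∈ S, ((P i).length - 1)

open Classical in
/-- The parameter `ℓ`: the minimum number of arcs in a solution if there is one, and the number of
vertices otherwise. -/
noncomputable def ell : ℕ :=
  if I.IsYes then sInf {m | ∃ S P, I.IsSolution S P ∧ I.numArcs S P = m} else I.n

end MVDSP

/-! ### The machine model

Deterministic random access machines in the comparison-addition model, programmed by structured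
programs. A machine has word variables and arrays of words (words are natural numbers, and serve
as array indices), and number variables and arrays of numbers (nonnegative rationals: the arc
lengths). A program is a fixed finite text; it names finitely many variables and arrays. Words can
be added, subtracted (truncated at `0`) and compared; numbers can only be added and compared. Every
elementary operation costs one unit. There is no multiplication, so after `T` steps all entries
have bit length at most `O(T)` plus the total bit length of the input (all denominators divide the
product of the input denominators), and the model is polynomially related to Turing machines. -/

namespace RAM

/-- The memory. -/
structure State where
  /-- word variables -/
  var : ℕ → ℕ
  /-- `arr a i` is the `i`-th entry of the word array `a` -/
  arr : ℕ → ℕ → ℕ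
  /-- number variables -/
  qvar : ℕ → ℚ≥0
  /-- `qarr a i` is the `i`-th entry of the number array `a` -/
  qarr : ℕ → ℕ → ℚ≥0

/-- Word expressions. -/
inductive NExp where
  | lit (m : ℕ)
  | var (x : ℕ)
  | get (a : ℕ) (i : NExp)
  | add (e f : NExp)
  | sub (e f : NExp)

/-- Number expressions. -/
inductive QExp where
  | zero
  | var (x : ℕ)
  | get (a : ℕ) (i : NExp)
  | add (e f : QExp)

/-- Tests. -/
inductive BExp where
  | le (e f : NExp)
  | qle (e f : QExp)
  | not (b : BExp)
  | and (b d : BExp)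

/-- The value of a word expression. -/
def NExp.eval (σ : State) : NExp → ℕ
  | lit m => m
  | var x => σ.var x
  | get a i => σ.arr a (i.eval σ)
  | add e f => e.eval σ + f.eval σ
  | sub e f => e.eval σ - f.eval σ

/-- The number of operations that the evaluation of a word expression takes. -/
def NExp.cost : NExp → ℕ
  | lit _ => 1
  | var _ => 1
  | get _ i => i.cost + 1
  | add e f => e.cost + f.cost + 1
  | sub e f => e.cost + f.cost + 1

/-- The value of a number expression. -/
def QExp.eval (σ : State) : QExp → ℚ≥0
  | zero => 0
  | var x => σ.qvar x
  | get a i => σ.qarr a (i.eval σ)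
  | add e f => e.eval σ + f.eval σ

/-- The number of operations that the evaluation of a number expression takes. -/
def QExp.cost : QExp → ℕ
  | zero => 1
  | var _ => 1
  | get _ i => i.cost + 1
  | add e f => e.cost + f.cost + 1

/-- The outcome of a test. -/
def BExp.Holds (σ : State) : BExp → Prop
  | le e f => e.eval σ ≤ f.eval σ
  | qle e f => e.eval σ ≤ f.eval σ
  | not b => ¬ b.Holds σ
  | and b d => b.Holds σ ∧ d.Holds σ

/-- The number of operations that a test takes. -/
def BExp.cost : BExp → ℕ
  | le e f => e.cost + f.cost + 1
  | qle e f => e.cost + f.cost + 1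
  | not b => b.cost + 1
  | and b d => b.cost + d.cost + 1

/-- Programs. -/
inductive Prog where
  | skip
  | set (x : ℕ) (e : NExp)
  | put (a : ℕ) (i e : NExp)
  | qset (x : ℕ) (e : QExp)
  | qput (a : ℕ) (i : NExp) (e : QExp)
  | seq (c d : Prog)
  | ite (b : BExp) (c d : Prog)
  | while (b : BExp) (c : Prog)

open Function in
/-- `Runs c σ T τ`: started in the memory `σ`, the program `c` halts after exactly `T` steps with
the memory `τ`. -/
inductive Runs : Prog → State → ℕ → State → Prop
  | skip (σ : State) : Runs .skip σ 1 σ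
  | set (σ : State) (x : ℕ) (e : NExp) :
      Runs (.set x e) σ (e.cost + 1) { σ with var := update σ.var x (e.eval σ) }
  | put (σ : State) (a : ℕ) (i e : NExp) :
      Runs (.put a i e) σ (i.cost + e.cost + 1)
        { σ with arr := update σ.arr a (update (σ.arr a) (i.eval σ) (e.eval σ)) }
  | qset (σ : State) (x : ℕ) (e : QExp) :
      Runs (.qset x e) σ (e.cost + 1) { σ with qvar := update σ.qvar x (e.eval σ) }
  | qput (σ : State) (a : ℕ) (i : NExp) (e : QExp) :
      Runs (.qput a i e) σ (i.cost + e.cost + 1)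
        { σ with qarr := update σ.qarr a (update (σ.qarr a) (i.eval σ) (e.eval σ)) }
  | seq {c d : Prog} {σ τ υ : State} {T U : ℕ} :
      Runs c σ T τ → Runs d τ U υ → Runs (.seq c d) σ (T + U) υ
  | ite_true {b : BExp} {c d : Prog} {σ τ : State} {T : ℕ} :
      b.Holds σ → Runs c σ T τ → Runs (.ite b c d) σ (b.cost + T) τ
  | ite_false {b : BExp} {c d : Prog} {σ τ : State} {T : ℕ} :
      ¬ b.Holds σ → Runs d σ T τ → Runs (.ite b c d) σ (b.cost + T) τ
  | while_true {b : BExp} {c : Prog} {σ τ υ : State} {T U : ℕ} :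
      b.Holds σ → Runs c σ T τ → Runs (.while b c) τ U υ →
      Runs (.while b c) σ (b.cost + T + U) υ
  | while_false {b : BExp} {c : Prog} {σ : State} :
      ¬ b.Holds σ → Runs (.while b c) σ b.cost σ

end RAM

open Classical in
/-- The memory that presents the instance `I` to a machine: `n`, `k`, `p` in the word variables
`0`, `1`, `2`; the adjacency matrix, row by row (the entry of `(u, v)` at index `u * n + v`), in the
word array `0`; the terminals `s i` and `t i` in the word arrays `1` and `2`; the lengths of the
arcs in the number array `0`, laid out as the adjacency matrix; zero everywhere else. -/
noncomputable def MVDSP.input (I : MVDSP) : RAM.State where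
  var x := if x = 0 then I.n else if x = 1 then I.k else if x = 2 then I.p else 0
  arr a j :=
    if a = 0 then
      if h : j < I.n * I.n then
        let e := finProdFinEquiv.symm ⟨j, h⟩
        if I.G.Adj e.1 e.2 then 1 else 0
      else 0
    else if a = 1 then if h : j < I.k then (I.s ⟨j, h⟩ : ℕ) else 0
    else if a = 2 then if h : j < I.k then (I.t ⟨j, h⟩ : ℕ) else 0
    else 0
  qvar _ := 0
  qarr a j :=
    if a = 0 then
      if h : j < I.n * I.n then
        let e := finProdFinEquiv.symm ⟨j, h⟩
        if I.G.Adj e.1 e.2 then I.w e.1 e.2 else 0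
      else 0
    else 0

/-- On the instance `I` the program `c` halts within `B` steps with the correct answer in the word
variable `0`: `1` for a yes-instance, `0` for a no-instance. -/
def MVDSP.DecidedBy (I : MVDSP) (c : RAM.Prog) (B : ℕ) : Prop :=
  ∃ T τ, RAM.Runs c I.input T τ ∧ T ≤ B ∧
    (I.IsYes → τ.var 0 = 1) ∧ (¬ I.IsYes → τ.var 0 = 0)

/-! A solution is traced by a walk in a graph of states `(j, i, v)`: `j` paths have been begun, the
current one serves the pair `i`, and it has reached the vertex `v`. Each path is followed backwards
from `t i` to `s i` along arcs that are tight for the distances to `t i`, so every piece walked is a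
shortest path. The states remember neither the visited vertices nor the used pairs. It is enough to
ask that all vertices visited by the walk are distinct: this gives simple and disjoint paths, and a
pair used twice would repeat its start. Hence the instance is a yes-instance iff, for some `m`, a
walk with `m` steps and distinct labels leads to a final state (`isYes_of_walk`,
`IsYes.exists_walk`).

Distinctness is detected algebraically and without randomness. The Vandermonde determinant of the
`m` labels of a walk vanishes iff a label repeats. The sum of the squares of these determinants over
all walks is a sum of nonnegative integers, so nothing cancels, and it is nonzero iff some walk has
distinct labels (`walkSum_range_ne_zero_iff`). Expanding both factors of each square along the
column of the last label gives a recurrence over pairs `(X, Y)` of sets of rows (`walkSum_eq`), that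
is, a table with `4 ^ m` entries per state.

The values `m = 0, 1, …, n` are tried in turn until one succeeds. Since `s i ≠ t i`, a path has at
most twice as many vertices as arcs, so a yes-instance succeeds at some `m ≤ 2ℓ`; in a no-instance
`ℓ = n` and `m ≤ n` throughout. So `ℓ` need not be known. Every loop makes at most `N = 2 ^ (2ℓ) *
(n + k + 1) ^ 3` rounds, and a fixed program with such loops takes time polynomial in `N`
(`Prog.exists_bound_le`). -/

/-! ### A logic for bounded runs -/

namespace RAM

/-- An upper bound for the number of steps of a program all of whose loops make at most `N`
rounds. -/
def Prog.bound (N : ℕ) : Prog → ℕ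
  | .skip => 1
  | .set _ e => e.cost + 1
  | .put _ i e => i.cost + e.cost + 1
  | .qset _ e => e.cost + 1
  | .qput _ i e => i.cost + e.cost + 1
  | .seq c d => c.bound N + d.bound N
  | .ite b c d => b.cost + c.bound N + d.bound N
  | .while b c => N * (b.cost + c.bound N) + b.cost

/-- Each loop contributes one factor `N`, so the bound is a polynomial in `N` of degree at most the
nesting depth. One constant serves as coefficient and as exponent, which makes such bounds closed
under addition (`key`). -/
theorem Prog.exists_bound_le (c : Prog) : ∃ C, ∀ N, c.bound N ≤ C * (N + 1) ^ C := by
  have key : ∀ a b N : ℕ, a * (N + 1) ^ a + b * (N + 1) ^ b ≤ (a + b) * (N + 1) ^ (a + b) := by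
    intro a b N
    have h1 : (N + 1) ^ a ≤ (N + 1) ^ (a + b) := Nat.pow_le_pow_right (by omega) (by omega)
    have h2 : (N + 1) ^ b ≤ (N + 1) ^ (a + b) := Nat.pow_le_pow_right (by omega) (by omega)
    nlinarith [Nat.mul_le_mul_left a h1, Nat.mul_le_mul_left b h2]
  have const : ∀ a N : ℕ, a ≤ a * (N + 1) ^ a := fun a N =>
    Nat.le_mul_of_pos_right _ (by positivity)
  induction c with
  | skip => exact ⟨1, fun N => const 1 N⟩
  | set x e => exact ⟨_, fun N => const _ N⟩
  | put a i e => exact ⟨_, fun N => const _ N⟩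
  | qset x e => exact ⟨_, fun N => const _ N⟩
  | qput a i e => exact ⟨_, fun N => const _ N⟩
  | seq c d hc hd =>
    obtain ⟨C, hC⟩ := hc
    obtain ⟨D, hD⟩ := hd
    exact ⟨C + D, fun N => (add_le_add (hC N) (hD N)).trans (key C D N)⟩
  | ite b c d hc hd =>
    obtain ⟨C, hC⟩ := hc
    obtain ⟨D, hD⟩ := hd
    exact ⟨b.cost + C + D, fun N => (add_le_add (add_le_add (const _ N) (hC N)) (hD N)).trans
      ((Nat.add_le_add_right (key _ _ N) _).trans (key _ _ N))⟩
  -- The remaining case is the loop; its factor `N` raises the exponent by one.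
  | _ b c hc =>
    obtain ⟨C, hC⟩ := hc
    refine ⟨b.cost + C + 1 + b.cost, fun N => ?_⟩
    refine (Nat.add_le_add ?_ (const b.cost N)).trans (key _ _ N)
    calc N * (b.cost + c.bound N)
        ≤ (N + 1) * ((b.cost + C) * (N + 1) ^ (b.cost + C)) :=
          Nat.mul_le_mul (by omega) ((add_le_add (const _ N) (hC N)).trans (key _ _ N))
      _ = (b.cost + C) * (N + 1) ^ (b.cost + C + 1) := by ring
      _ ≤ _ := Nat.mul_le_mul_right _ (by omega)

/-- Whether a program assigns to the word variable `x`. -/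
def Prog.wv : Prog → ℕ → Bool
  | .set y _, x => y == x
  | .seq c d, x => c.wv x || d.wv x
  | .ite _ c d, x => c.wv x || d.wv x
  | .while _ c, x => c.wv x
  | _, _ => false

/-- Whether a program assigns to the word array `x`. -/
def Prog.wa : Prog → ℕ → Bool
  | .put y _ _, x => y == x
  | .seq c d, x => c.wa x || d.wa x
  | .ite _ c d, x => c.wa x || d.wa x
  | .while _ c, x => c.wa x
  | _, _ => false

/-- Whether a program assigns to the number array `x`. -/
def Prog.wqa : Prog → ℕ → Bool
  | .qput y _ _, x => y == x
  | .seq c d, x => c.wqa x || d.wqa x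
  | .ite _ c d, x => c.wqa x || d.wqa x
  | .while _ c, x => c.wqa x
  | _, _ => false

/-- The two memories agree wherever `c` does not write. -/
structure Agree (c : Prog) (σ τ : State) : Prop where
  var : ∀ x, c.wv x = false → τ.var x = σ.var x
  arr : ∀ x, c.wa x = false → τ.arr x = σ.arr x
  qarr : ∀ x, c.wqa x = false → τ.qarr x = σ.qarr x

theorem Agree.rfl {c : Prog} {σ : State} : Agree c σ σ :=
  ⟨fun _ _ => .refl _, fun _ _ => .refl _, fun _ _ => .refl _⟩

theorem Agree.trans {c : Prog} {σ τ υ : State} (h : Agree c σ τ) (h' : Agree c τ υ) :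
    Agree c σ υ :=
  ⟨fun x hx => (h'.var x hx).trans (h.var x hx), fun x hx => (h'.arr x hx).trans (h.arr x hx),
    fun x hx => (h'.qarr x hx).trans (h.qarr x hx)⟩

theorem Agree.mono {c d : Prog} {σ τ : State} (h : Agree c σ τ)
    (hv : ∀ x, d.wv x = false → c.wv x = false) (ha : ∀ x, d.wa x = false → c.wa x = false)
    (hq : ∀ x, d.wqa x = false → c.wqa x = false) : Agree d σ τ :=
  ⟨fun x hx => h.var x (hv x hx), fun x hx => h.arr x (ha x hx), fun x hx => h.qarr x (hq x hx)⟩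

theorem Agree.seq_left {c d : Prog} {σ τ : State} (h : Agree c σ τ) : Agree (.seq c d) σ τ :=
  h.mono (by simp +contextual [Prog.wv]) (by simp +contextual [Prog.wa])
    (by simp +contextual [Prog.wqa])

theorem Agree.seq_right {c d : Prog} {σ τ : State} (h : Agree d σ τ) : Agree (.seq c d) σ τ :=
  h.mono (by simp +contextual [Prog.wv]) (by simp +contextual [Prog.wa])
    (by simp +contextual [Prog.wqa])

/-- The frame rule. The written locations can be read off the program text, so for concrete programs
its side conditions are settled by `decide`. Number variables play no part because `program` uses
none. -/
theorem Runs.agree {c : Prog} {σ τ : State} {T : ℕ} (h : Runs c σ T τ) : Agree c σ τ := by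
  induction h with
  | skip σ => exact .rfl
  | set σ x e =>
    refine ⟨fun y hy => ?_, fun _ _ => rfl, fun _ _ => rfl⟩
    simp only [Prog.wv, beq_eq_false_iff_ne] at hy
    exact Function.update_of_ne hy.symm _ _
  | put σ a i e =>
    refine ⟨fun _ _ => rfl, fun y hy => ?_, fun _ _ => rfl⟩
    simp only [Prog.wa, beq_eq_false_iff_ne] at hy
    exact Function.update_of_ne hy.symm _ _
  | qset σ x e => exact ⟨fun _ _ => rfl, fun _ _ => rfl, fun _ _ => rfl⟩
  | qput σ a i e =>
    refine ⟨fun _ _ => rfl, fun _ _ => rfl, fun y hy => ?_⟩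
    simp only [Prog.wqa, beq_eq_false_iff_ne] at hy
    exact Function.update_of_ne hy.symm _ _
  | seq _ _ h₁ h₂ => exact h₁.seq_left.trans h₂.seq_right
  | ite_true _ _ h =>
    exact h.mono (by simp +contextual [Prog.wv]) (by simp +contextual [Prog.wa])
      (by simp +contextual [Prog.wqa])
  | ite_false _ _ h =>
    exact h.mono (by simp +contextual [Prog.wv]) (by simp +contextual [Prog.wa])
      (by simp +contextual [Prog.wqa])
  | while_true _ _ _ h h' =>
    exact (h.mono (by simp [Prog.wv]) (by simp [Prog.wa]) (by simp [Prog.wqa])).trans h'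
  | while_false _ => exact .rfl

/-- Started in `σ`, the program `c` halts within `c.bound N` steps in a memory that satisfies
`Q`. -/
def Exec (N : ℕ) (c : Prog) (σ : State) (Q : State → Prop) : Prop :=
  ∃ T τ, Runs c σ T τ ∧ T ≤ c.bound N ∧ Q τ

/-- `σ` with `v` assigned to the word variable `x`. -/
def State.setVar (σ : State) (x v : ℕ) : State := { σ with var := Function.update σ.var x v }

/-- `σ` with `v` assigned to the `i`-th entry of the word array `a`. -/
def State.setArr (σ : State) (a i v : ℕ) : State :=
  { σ with arr := Function.update σ.arr a (Function.update (σ.arr a) i v) }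

/-- `σ` with `v` assigned to the `i`-th entry of the number array `a`. -/
def State.setQArr (σ : State) (a i : ℕ) (v : ℚ≥0) : State :=
  { σ with qarr := Function.update σ.qarr a (Function.update (σ.qarr a) i v) }

section StateLemmas
variable (σ : State) (x y v a i b : ℕ) (w : ℚ≥0)

@[simp] theorem State.setVar_var : (σ.setVar x v).var y = if y = x then v else σ.var y :=
  Function.update_apply ..
@[simp] theorem State.setVar_arr : (σ.setVar x v).arr = σ.arr := rfl
@[simp] theorem State.setVar_qarr : (σ.setVar x v).qarr = σ.qarr := rfl
@[simp] theorem State.setArr_var : (σ.setArr a i v).var = σ.var := rfl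
@[simp] theorem State.setArr_arr : (σ.setArr a i v).arr b =
    if b = a then Function.update (σ.arr a) i v else σ.arr b :=
  Function.update_apply ..
@[simp] theorem State.setArr_qarr : (σ.setArr a i v).qarr = σ.qarr := rfl
@[simp] theorem State.setQArr_var : (σ.setQArr a i w).var = σ.var := rfl
@[simp] theorem State.setQArr_arr : (σ.setQArr a i w).arr = σ.arr := rfl
@[simp] theorem State.setQArr_qarr : (σ.setQArr a i w).qarr b =
    if b = a then Function.update (σ.qarr a) i w else σ.qarr b :=
  Function.update_apply ..

end StateLemmas

/-! ### Hoare-style rules for bounded execution. -/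

section Rules
variable {N : ℕ} {σ : State} {Q : State → Prop}

theorem Exec.mono {c : Prog} {Q' : State → Prop} (h : Exec N c σ Q')
    (hQ : ∀ τ, Agree c σ τ → Q' τ → Q τ) : Exec N c σ Q := by
  obtain ⟨T, τ, h₁, h₂, h₃⟩ := h
  exact ⟨T, τ, h₁, h₂, hQ τ h₁.agree h₃⟩

theorem Exec.skip (h : Q σ) : Exec N .skip σ Q := ⟨_, _, .skip σ, le_rfl, h⟩

theorem Exec.set {x : ℕ} {e : NExp} (h : Q (σ.setVar x (e.eval σ))) : Exec N (.set x e) σ Q :=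
  ⟨_, _, .set σ x e, le_rfl, h⟩

theorem Exec.put {a : ℕ} {i e : NExp} (h : Q (σ.setArr a (i.eval σ) (e.eval σ))) :
    Exec N (.put a i e) σ Q :=
  ⟨_, _, .put σ a i e, le_rfl, h⟩

theorem Exec.qput {a : ℕ} {i : NExp} {e : QExp} (h : Q (σ.setQArr a (i.eval σ) (e.eval σ))) :
    Exec N (.qput a i e) σ Q :=
  ⟨_, _, .qput σ a i e, le_rfl, h⟩

theorem Exec.seq {c d : Prog} (h : Exec N c σ (fun τ => Exec N d τ Q)) :
    Exec N (.seq c d) σ Q := by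
  obtain ⟨T, τ, h₁, h₂, U, υ, h₃, h₄, h₅⟩ := h
  exact ⟨_, _, .seq h₁ h₃, add_le_add h₂ h₄, h₅⟩

theorem Exec.ite {b : BExp} {c d : Prog} (hc : b.Holds σ → Exec N c σ Q)
    (hd : ¬ b.Holds σ → Exec N d σ Q) : Exec N (.ite b c d) σ Q := by
  by_cases hb : b.Holds σ
  · obtain ⟨T, τ, h₁, h₂, h₃⟩ := hc hb
    exact ⟨_, _, .ite_true hb h₁, by simp only [Prog.bound]; omega, h₃⟩
  · obtain ⟨T, τ, h₁, h₂, h₃⟩ := hd hb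
    exact ⟨_, _, .ite_false hb h₁, by simp only [Prog.bound]; omega, h₃⟩

/-- `x < e` as a test. -/
def BExp.lt (e f : NExp) : BExp := .not (.le f e)

/-- Equality of words as a test. -/
def BExp.eq (e f : NExp) : BExp := .and (.le e f) (.le f e)

/-- Disjunction of tests. -/
def BExp.or (b d : BExp) : BExp := .not (.and (.not b) (.not d))

@[simp] theorem BExp.holds_lt {e f : NExp} : (BExp.lt e f).Holds σ ↔ e.eval σ < f.eval σ := by
  simp [BExp.lt, BExp.Holds]

@[simp] theorem BExp.holds_eq {e f : NExp} : (BExp.eq e f).Holds σ ↔ e.eval σ = f.eval σ := by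
  simp [BExp.eq, BExp.Holds, le_antisymm_iff]

@[simp] theorem BExp.holds_or {b d : BExp} : (BExp.or b d).Holds σ ↔ b.Holds σ ∨ d.Holds σ := by
  simp only [BExp.or, BExp.Holds]; tauto

@[simp] theorem BExp.holds_and {b d : BExp} :
    (BExp.and b d).Holds σ ↔ b.Holds σ ∧ d.Holds σ := .rfl

@[simp] theorem BExp.holds_le {e f : NExp} : (BExp.le e f).Holds σ ↔ e.eval σ ≤ f.eval σ := .rfl

@[simp] theorem BExp.holds_not {b : BExp} : (BExp.not b).Holds σ ↔ ¬ b.Holds σ := .rfl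

@[simp] theorem BExp.holds_qle {e f : QExp} :
    (BExp.qle e f).Holds σ ↔ e.eval σ ≤ f.eval σ := .rfl

attribute [simp] NExp.eval QExp.eval

/-- `for x = 0, …, e - 1 do c`. -/
def Prog.forLoop (x : ℕ) (e : NExp) (c : Prog) : Prog :=
  .seq (.set x (.lit 0))
    (.while (.lt (.var x) e) (.seq c (.set x (.add (.var x) (.lit 1)))))

/-- The invariant is indexed by the round and not read off the counter, so it has to survive
assignments to `x` (`stable`). As the body does not write `x` and the limit `e` keeps its value,
there are exactly `M` rounds, which is where `M ≤ N` bounds the time. -/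
theorem Exec.forLoop {M x : ℕ} {e : NExp} {c : Prog} (Inv : ℕ → State → Prop) (hM : M ≤ N)
    (hx : c.wv x = false)
    (he : ∀ τ, Agree (.forLoop x e c) σ τ → e.eval τ = M)
    (stable : ∀ i τ v, Inv i τ → Inv i (τ.setVar x v))
    (start : Inv 0 σ)
    (step : ∀ i < M, ∀ τ, Agree (.forLoop x e c) σ τ → τ.var x = i → Inv i τ →
      Exec N c τ (Inv (i + 1)))
    (post : ∀ τ, Agree (.forLoop x e c) σ τ → Inv M τ → Q τ) :
    Exec N (.forLoop x e c) σ Q := by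
  set W : Prog := .while (.lt (.var x) e) (.seq c (.set x (.add (.var x) (.lit 1)))) with hW
  -- Induction on the number `r` of rounds still to be made.
  have hloop : ∀ r i τ, i + r = M → Agree (.forLoop x e c) σ τ → τ.var x = i → Inv i τ →
      ∃ T υ, Runs W τ T υ ∧
        T ≤ r * ((BExp.lt (.var x) e).cost +
          (Prog.seq c (.set x (.add (.var x) (.lit 1)))).bound N) + (BExp.lt (.var x) e).cost ∧
        Agree (.forLoop x e c) σ υ ∧ Inv M υ := by
    intro r
    induction r with
    | zero =>
      intro i τ hi hτ hxi hInv
      refine ⟨_, τ, .while_false ?_, by simp, hτ, ?_⟩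
      · simp [he τ hτ, hxi]; omega
      · rwa [← hi]
    | succ r ih =>
      intro i τ hi hτ hxi hInv
      obtain ⟨T, υ, h₁, h₂, h₃⟩ := step i (by omega) τ hτ hxi hInv
      have hrun := Runs.seq h₁ (.set υ x (.add (.var x) (.lit 1)))
      have hυx : υ.var x = i := (h₁.agree.var x hx).trans hxi
      have hag := hτ.trans (Agree.seq_right (c := .set x (.lit 0))
        (d := W) (hrun.agree.mono (by simp [W, Prog.wv]) (by simp [W, Prog.wa])
          (by simp [W, Prog.wqa])))
      obtain ⟨U, ω, g₁, g₂, g₃, g₄⟩ := ih (i + 1) _ (by omega) hag (by simp [hυx])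
        (stable _ _ _ h₃)
      refine ⟨_, ω, .while_true ?_ hrun g₁, ?_, g₃, g₄⟩
      · simp [he τ hτ, hxi]; omega
      · simp only [Prog.bound, Nat.succ_mul] at g₂ ⊢
        omega
  have h0 : Runs (.set x (.lit 0)) σ 2 (σ.setVar x 0) := .set σ x (.lit 0)
  obtain ⟨T, υ, h₁, h₂, h₃, h₄⟩ := hloop M 0 (σ.setVar x 0) (by omega) h0.agree.seq_left
    (by simp) (stable _ _ _ start)
  refine ⟨_, υ, .seq h0 h₁, ?_, post υ h₃ h₄⟩
  refine add_le_add (by rfl) (h₂.trans ?_)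
  exact Nat.add_le_add_right (Nat.mul_le_mul_right _ hM) _

end Rules

end RAM

/-! ### Vandermonde minors and sums over walks -/

/-- The sign with which the `a`-th row enters when it is split off from the rows in `X`. -/
def rowSign (X : Finset ℕ) (a : ℕ) : ℤ := (-1) ^ (X.filter (a < ·)).card

/-- The minor of the Vandermonde matrix with columns `(v ^ a)_a`, for `v` in the list, and rows in
`X`, expanded along its columns. -/
def vandermondeMinor : List ℕ → Finset ℕ → ℤ
  | [], X => if X = ∅ then 1 else 0
  | v :: l, X => ∑ a ∈ X, rowSign X a * (v : ℤ) ^ a * vandermondeMinor l (X.erase a)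

/-- Removing the smaller row `a` leaves the number of rows above `b` unchanged, whereas removing `b`
lowers the number of rows above `a` by one. -/
theorem rowSign_mul_rowSign_erase {X : Finset ℕ} {a b : ℕ} (hb : b ∈ X)
    (hab : a < b) : rowSign X a * rowSign (X.erase a) b = -(rowSign X b * rowSign (X.erase b) a) := by
  have h1 : (X.erase a).filter (b < ·) = X.filter (b < ·) := by
    ext x; simp only [Finset.mem_filter, Finset.mem_erase]; constructor
    · tauto
    · rintro ⟨h, h'⟩; exact ⟨⟨by omega, h⟩, h'⟩
  have h2 : X.filter (a < ·) = insert b ((X.erase b).filter (a < ·)) := by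
    ext x; simp only [Finset.mem_filter, Finset.mem_erase, Finset.mem_insert]; constructor
    · rintro ⟨h, h'⟩
      by_cases hx : x = b
      · exact .inl hx
      · exact .inr ⟨⟨hx, h⟩, h'⟩
    · rintro (rfl | h)
      · exact ⟨hb, hab⟩
      · exact ⟨h.1.2, h.2⟩
  rw [rowSign, rowSign, rowSign, rowSign, h1, h2, Finset.card_insert_of_notMem (by simp)]
  ring

theorem rowSign_antisymm {X : Finset ℕ} {a b : ℕ} (ha : a ∈ X) (hb : b ∈ X)
    (hab : a ≠ b) : rowSign X a * rowSign (X.erase a) b = -(rowSign X b * rowSign (X.erase b) a) := by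
  rcases lt_or_gt_of_ne hab with h | h
  · exact rowSign_mul_rowSign_erase hb h
  · rw [rowSign_mul_rowSign_erase ha h, neg_neg]

/-- Expand along two columns: exchanging the two chosen rows matches the terms of both sides, with
opposite signs by `rowSign_antisymm`. -/
theorem vandermondeMinor_swap (u v : ℕ) (l : List ℕ) (X : Finset ℕ) :
    vandermondeMinor (u :: v :: l) X = -vandermondeMinor (v :: u :: l) X := by
  simp only [vandermondeMinor, Finset.mul_sum]
  rw [Finset.sum_sigma', Finset.sum_sigma', ← Finset.sum_neg_distrib]
  refine Finset.sum_nbij' (fun x => ⟨x.2, x.1⟩) (fun x => ⟨x.2, x.1⟩) ?_ ?_ ?_ ?_ ?_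
  · rintro ⟨a, b⟩ h; simp only [Finset.mem_sigma, Finset.mem_erase] at h ⊢
    exact ⟨h.2.2, h.2.1.symm, h.1⟩
  · rintro ⟨a, b⟩ h; simp only [Finset.mem_sigma, Finset.mem_erase] at h ⊢
    exact ⟨h.2.2, h.2.1.symm, h.1⟩
  · intros; rfl
  · intros; rfl
  · rintro ⟨a, b⟩ h
    simp only [Finset.mem_sigma, Finset.mem_erase] at h
    have := rowSign_antisymm h.1 h.2.2 h.2.1.symm
    rw [Finset.erase_right_comm]
    calc _ = (rowSign X a * rowSign (X.erase a) b) *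
          ((u : ℤ) ^ a * (v : ℤ) ^ b * vandermondeMinor l ((X.erase b).erase a)) := by ring
      _ = _ := by rw [this]; ring

/-- That `ε` is a sign is not recorded: some factor independent of `X` suffices to transfer
vanishing. -/
theorem vandermondeMinor_perm {l l' : List ℕ} (h : l.Perm l') :
    ∃ ε : ℤ, ∀ X, vandermondeMinor l X = ε * vandermondeMinor l' X := by
  induction h with
  | nil => exact ⟨1, fun X => by simp⟩
  | cons x _ ih =>
    obtain ⟨ε, h⟩ := ih
    refine ⟨ε, fun X => ?_⟩
    simp only [vandermondeMinor, Finset.mul_sum, h]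
    exact Finset.sum_congr rfl fun _ _ => by ring
  | swap x y l => exact ⟨-1, fun X => by rw [vandermondeMinor_swap]; ring⟩
  | trans _ _ ih₁ ih₂ =>
    obtain ⟨ε, h⟩ := ih₁
    obtain ⟨δ, h'⟩ := ih₂
    exact ⟨ε * δ, fun X => by rw [h, h']; ring⟩

/-- Move the other copy of `v` to the second place; by `vandermondeMinor_swap` the result equals its
own negative. -/
theorem vandermondeMinor_cons_of_mem {v : ℕ} {l : List ℕ} (h : v ∈ l) (X : Finset ℕ) :
    vandermondeMinor (v :: l) X = 0 := by
  obtain ⟨ε, hε⟩ := vandermondeMinor_perm ((List.perm_cons_erase h).cons v)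
  have := vandermondeMinor_swap v v (l.erase v) X
  rw [hε, show vandermondeMinor (v :: v :: l.erase v) X = 0 by omega, mul_zero]

theorem vandermondeMinor_eq_zero_of_not_nodup {l : List ℕ} (h : ¬ l.Nodup) (X : Finset ℕ) :
    vandermondeMinor l X = 0 := by
  induction l generalizing X with
  | nil => simp at h
  | cons v l ih =>
    by_cases hv : v ∈ l
    · exact vandermondeMinor_cons_of_mem hv X
    · have hl : ¬ l.Nodup := fun h' => h (List.nodup_cons.2 ⟨hv, h'⟩)
      simp [vandermondeMinor, ih hl]

/-- Replace the first label by an indeterminate. The resulting polynomial `f` has degree at most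
`m`, and its coefficient at `m` is the minor for `l`, nonzero by induction. If the minor for `v ::
l` vanished, `v` and the `m` entries of `l` would be `m + 1` distinct roots. -/
theorem vandermondeMinor_range_ne_zero {l : List ℕ} (h : l.Nodup) :
    vandermondeMinor l (Finset.range l.length) ≠ 0 := by
  induction l with
  | nil => simp [vandermondeMinor]
  | cons v l ih =>
    obtain ⟨hv, hl⟩ := List.nodup_cons.1 h
    set m := l.length
    let X := Finset.range (m + 1)
    let f : Polynomial ℤ := ∑ a ∈ X,
      Polynomial.monomial a (rowSign X a * vandermondeMinor l (X.erase a))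
    have heval : ∀ u : ℕ, f.eval (u : ℤ) = vandermondeMinor (u :: l) X := by
      intro u
      simp only [f, Polynomial.eval_finsetSum, Polynomial.eval_monomial, vandermondeMinor]
      exact Finset.sum_congr rfl fun _ _ => by ring
    have hcoeff : f.coeff m = vandermondeMinor l (Finset.range m) := by
      have h1 : X.erase m = Finset.range m := by
        ext x; simp only [X, Finset.mem_erase, Finset.mem_range]; omega
      have h2 : X.filter (m < ·) = ∅ := by
        ext x; simp only [X, Finset.mem_filter, Finset.mem_range, Finset.notMem_empty, iff_false]; omega
      simp only [f, Polynomial.finsetSum_coeff, Polynomial.coeff_monomial]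
      rw [Finset.sum_ite_eq' , if_pos (by simp [X]), h1, rowSign, h2]
      simp
    have hdeg : f.natDegree < m + 1 := by
      refine Nat.lt_succ_of_le (Polynomial.natDegree_sum_le_of_forall_le _ _ fun a ha => ?_)
      exact (Polynomial.natDegree_monomial_le _).trans (by simpa [X, Nat.lt_succ_iff] using ha)
    intro hzero
    have hf : f = 0 := by
      refine Polynomial.eq_zero_of_natDegree_lt_card_of_eval_eq_zero' f
        ((v :: l).toFinset.image (Nat.cast : ℕ → ℤ)) ?_ ?_
      · intro x hx
        simp only [Finset.mem_image, List.mem_toFinset, List.mem_cons] at hx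
        obtain ⟨u, rfl | hu, rfl⟩ := hx
        · rw [heval]; exact hzero
        · rw [heval]; exact vandermondeMinor_cons_of_mem hu X
      · rw [Finset.card_image_of_injective _ Nat.cast_injective, List.toFinset_card_of_nodup h]
        exact hdeg
    exact ih hl (by rw [← hcoeff, hf, Polynomial.coeff_zero])

/-! ### Detecting walks with distinct labels by sums of products of minors. -/

section Walks
open Classical

variable (Q : ℕ) (R : ℕ → ℕ → Prop) (lab : ℕ → ℕ)

/-- The label sequences, last label first, of the walks with `r` steps from `0` to `q` along `R`
inside `{0, …, Q - 1}`. The label of the start does not count. -/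
noncomputable def walkLabels : ℕ → ℕ → List (List ℕ)
  | 0, q => if q = 0 then [[]] else []
  | r + 1, q => (List.range Q).flatMap fun q' =>
      if R q' q then (walkLabels r q').map (lab q :: ·) else []

/-- The sum over all walks of the products of two minors. -/
noncomputable def walkSum (X Y : Finset ℕ) (q : ℕ) : ℤ :=
  ((walkLabels Q R lab X.card q).map
    fun l => vandermondeMinor l X * vandermondeMinor l Y).sum

variable {Q R lab}

theorem length_of_mem_walkLabels {r q : ℕ} {l : List ℕ} (h : l ∈ walkLabels Q R lab r q) :
    l.length = r := by
  induction r generalizing q l with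
  | zero => simp only [walkLabels] at h; split_ifs at h <;> simp_all
  | succ r ih =>
    simp only [walkLabels, List.mem_flatMap] at h
    obtain ⟨q', -, h⟩ := h
    split_ifs at h
    · obtain ⟨l', h', rfl⟩ := List.mem_map.1 h
      simp [ih h']
    · simp at h

theorem sum_map_finset_sum {α : Type*} (L : List α) (S : Finset ℕ) (f : α → ℕ → ℤ) :
    (L.map fun x => ∑ a ∈ S, f x a).sum = ∑ a ∈ S, (L.map fun x => f x a).sum := by
  induction L with
  | nil => simp
  | cons x L ih => simp [ih, Finset.sum_add_distrib]

/-- Delete the last step of the walk and expand both minors along the column of its label `lab q`.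
Both columns carry the same label, hence the exponent `a + b`. Erasing `a` from `X` also shortens
the walks by one, since their length is `X.card`. The first summand is the empty walk. -/
theorem walkSum_eq (X Y : Finset ℕ) (q : ℕ) :
    walkSum Q R lab X Y q = (if X = ∅ ∧ Y = ∅ ∧ q = 0 then 1 else 0) +
      ∑ b ∈ Y, rowSign Y b * ∑ a ∈ X, rowSign X a * ∑ q' ∈ Finset.range Q,
        if R q' q then (lab q : ℤ) ^ (a + b) * walkSum Q R lab (X.erase a) (Y.erase b) q'
        else 0 := by
  rcases X.eq_empty_or_nonempty with rfl | hX
  · by_cases hq : q = 0 <;> simp [walkSum, walkLabels, hq, vandermondeMinor]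
  · obtain ⟨r, hr⟩ : ∃ r, X.card = r + 1 := ⟨X.card - 1, by have := hX.card_pos; omega⟩
    rw [if_neg (by simp [hX.ne_empty]), zero_add, walkSum, hr]
    have h1 : ∀ L : List ℕ, ∀ g : ℕ → List (List ℕ), ∀ f : List ℕ → ℤ,
        ((L.flatMap g).map f).sum = (L.map fun x => ((g x).map f).sum).sum := by
      intro L g f
      induction L with
      | nil => simp
      | cons x L ih => simp [ih]
    have h2 : ∀ f : ℕ → ℤ, ((List.range Q).map f).sum = ∑ i ∈ Finset.range Q, f i := fun f => rfl
    simp only [walkLabels, h1, h2]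
    have h3 : ∀ q', ((if R q' q then (walkLabels Q R lab r q').map (lab q :: ·) else []).map
        fun l => vandermondeMinor l X * vandermondeMinor l Y).sum =
        ∑ b ∈ Y, ∑ a ∈ X, if R q' q then rowSign Y b * (rowSign X a * ((lab q : ℤ) ^ (a + b) *
          walkSum Q R lab (X.erase a) (Y.erase b) q')) else 0 := by
      intro q'
      split_ifs with hR
      · rw [List.map_map]
        simp only [Function.comp_def, vandermondeMinor, Finset.sum_mul_sum]
        simp only [sum_map_finset_sum]
        rw [Finset.sum_comm]
        refine Finset.sum_congr rfl fun b _ => Finset.sum_congr rfl fun a ha => ?_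
        rw [walkSum, Finset.card_erase_of_mem ha, hr, Nat.add_sub_cancel, ← List.sum_map_mul_left,
          ← List.sum_map_mul_left, ← List.sum_map_mul_left]
        refine congrArg List.sum (List.map_congr_left fun l _ => ?_)
        rw [pow_add]
        ring
      · simp
    simp only [h3]
    rw [Finset.sum_comm]
    refine Finset.sum_congr rfl fun b _ => ?_
    rw [Finset.sum_comm, Finset.mul_sum]
    refine Finset.sum_congr rfl fun a _ => ?_
    rw [Finset.mul_sum, Finset.mul_sum]
    refine Finset.sum_congr rfl fun q' _ => ?_
    split_ifs <;> simp

/-- For equal row sets the summands are squares of integers, so the sum vanishes only if every minor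
does. -/
theorem walkSum_range_ne_zero_iff {m q : ℕ} :
    walkSum Q R lab (Finset.range m) (Finset.range m) q ≠ 0 ↔
      ∃ l ∈ walkLabels Q R lab m q, l.Nodup := by
  have aux : ∀ (L : List (List ℕ)) (f : List ℕ → ℤ),
      0 ≤ (L.map fun l => f l * f l).sum ∧
        ((L.map fun l => f l * f l).sum = 0 ↔ ∀ l ∈ L, f l = 0) := by
    intro L f
    induction L with
    | nil => simp
    | cons x L ih =>
      have hx := mul_self_nonneg (f x)
      simp only [List.map_cons, List.sum_cons, List.mem_cons, forall_eq_or_imp]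
      refine ⟨add_nonneg hx ih.1, ?_⟩
      rw [add_eq_zero_iff_of_nonneg hx ih.1, ih.2, mul_self_eq_zero]
  rw [walkSum, Finset.card_range, Ne, (aux _ _).2]
  push Not
  refine exists_congr fun l => and_congr_right fun hl => ?_
  refine ⟨fun h => by_contra fun h' => h (vandermondeMinor_eq_zero_of_not_nodup h' _), fun h => ?_⟩
  rw [← length_of_mem_walkLabels hl]
  exact vandermondeMinor_range_ne_zero h

end Walks

/-! ### Bit sets of natural numbers -/

/-- The set of the positions of the ones in the binary expansion of `x`. -/
def bitSet (x : ℕ) : Finset ℕ := x.bitIndices.toFinset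

theorem sum_bitSet (x : ℕ) : ∑ a ∈ bitSet x, 2 ^ a = x := Finset.sum_toFinset_bitIndices_two_pow x

theorem bitSet_sum (S : Finset ℕ) : bitSet (∑ a ∈ S, 2 ^ a) = S :=
  Finset.toFinset_bitIndices_sum_two_pow S

theorem bitSet_sub {x a : ℕ} (h : a ∈ bitSet x) : bitSet (x - 2 ^ a) = (bitSet x).erase a := by
  have h1 := Finset.add_sum_erase (bitSet x) (fun a => 2 ^ a) h
  rw [sum_bitSet] at h1
  rw [show x - 2 ^ a = ∑ b ∈ (bitSet x).erase a, 2 ^ b by omega, bitSet_sum]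

theorem two_pow_le_of_mem_bitSet {x a : ℕ} (h : a ∈ bitSet x) : 2 ^ a ≤ x :=
  Nat.two_pow_le_of_mem_bitIndices (List.mem_toFinset.1 h)

theorem lt_of_mem_bitSet {x a m : ℕ} (hx : x < 2 ^ m) (h : a ∈ bitSet x) : a < m :=
  (Nat.pow_lt_pow_iff_right (by norm_num)).1 ((two_pow_le_of_mem_bitSet h).trans_lt hx)

theorem bitSet_two_pow_sub_one (m : ℕ) : bitSet (2 ^ m - 1) = Finset.range m := by
  rw [← bitSet_sum (Finset.range m), Nat.geomSum_eq le_rfl]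
  simp

theorem bitSet_eq_empty_iff {x : ℕ} : bitSet x = ∅ ↔ x = 0 := by
  constructor
  · intro h
    rw [← sum_bitSet x, h, Finset.sum_empty]
  · rintro rfl
    simp [bitSet]

/-- With the next lemma, this lets bits be read from the top by comparison and subtraction alone:
`a` is a one of `x` iff `2 ^ a ≤ x % 2 ^ (a + 1)`. -/
theorem mod_two_pow_succ_of_mem_bitSet {x a : ℕ} (h : a ∈ bitSet x) :
    x % 2 ^ (a + 1) = 2 ^ a + x % 2 ^ a := by
  have h' : x.testBit a = true := Nat.mem_bitIndices.1 (List.mem_toFinset.1 h)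
  rw [Nat.testBit_eq_decide_div_mod_eq, decide_eq_true_iff] at h'
  rw [Nat.mod_pow_succ, h', mul_one, add_comm]

theorem mod_two_pow_succ_of_notMem_bitSet {x a : ℕ} (h : a ∉ bitSet x) :
    x % 2 ^ (a + 1) = x % 2 ^ a := by
  have h' : x.testBit a = false := by
    by_contra h'
    exact h (List.mem_toFinset.2 (Nat.mem_bitIndices.2 (by simpa using h')))
  rw [Nat.testBit_eq_decide_div_mod_eq, decide_eq_false_iff_not] at h'
  rw [Nat.mod_pow_succ, show x / 2 ^ a % 2 = 0 by omega, mul_zero, add_zero]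

/-! ### Shortest paths and walks in the state graph -/

namespace MVDSP

variable {I : MVDSP}

theorem input_arr_zero (u v : Fin I.n) :
    I.input.arr 0 (u * I.n + v) = open Classical in if I.G.Adj u v then 1 else 0 := by
  have h : (u : ℕ) * I.n + v = (finProdFinEquiv (u, v) : Fin (I.n * I.n)) := by
    simp [finProdFinEquiv]; ring
  simp only [input, h]
  rw [if_pos trivial, dif_pos (Fin.is_lt _)]
  simp only [Fin.eta]
  rw [Equiv.symm_apply_apply]

theorem one_le_input_arr_zero {u v : Fin I.n} :
    1 ≤ I.input.arr 0 (u * I.n + v) ↔ I.G.Adj u v := by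
  rw [input_arr_zero]
  split_ifs <;> simp [*]

theorem input_qarr_zero {u v : Fin I.n} (hadj : I.G.Adj u v) :
    I.input.qarr 0 (u * I.n + v) = I.w u v := by
  have h : (u : ℕ) * I.n + v = (finProdFinEquiv (u, v) : Fin (I.n * I.n)) := by
    simp [finProdFinEquiv]; ring
  simp only [input, h]
  rw [if_pos trivial, dif_pos (Fin.is_lt _)]
  simp only [Fin.eta]
  rw [Equiv.symm_apply_apply, if_pos hadj]

theorem input_arr_one (i : Fin I.k) : I.input.arr 1 i = I.s i := by simp [input]

theorem input_arr_two (i : Fin I.k) : I.input.arr 2 i = I.t i := by simp [input]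

theorem pathLength_cons_cons (u v : Fin I.n) (l : List (Fin I.n)) :
    I.pathLength (u :: v :: l) = I.w u v + I.pathLength (v :: l) := by
  simp [pathLength]

theorem pathLength_le_append (A B : List (Fin I.n)) (u : Fin I.n) :
    I.pathLength (u :: B) ≤ I.pathLength (A ++ u :: B) := by
  induction A with
  | nil => simp
  | cons a A ih =>
    refine ih.trans ?_
    cases A with
    | nil => rw [List.nil_append, List.cons_append, List.nil_append, pathLength_cons_cons]; simp
    | cons b A =>
      rw [List.cons_append, List.cons_append, List.cons_append, pathLength_cons_cons]; simp

theorem IsPath.exists_eq_cons {u t : Fin I.n} {P : List (Fin I.n)} (h : I.IsPath u t P) :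
    ∃ l, P = u :: l := by
  cases P with
  | nil => simp [IsPath] at h
  | cons a l => exact ⟨l, by have := h.1; simp at this; rw [this]⟩

theorem isPath_singleton (t : Fin I.n) : I.IsPath t t [t] := by simp [IsPath]

theorem isShortestPath_singleton (t : Fin I.n) : I.IsShortestPath t t [t] :=
  ⟨isPath_singleton t, fun Q _ => by simp [pathLength]⟩

theorem isPath_cons_cons {u u' v t : Fin I.n} {l : List (Fin I.n)} :
    I.IsPath u t (u' :: v :: l) ↔
      u = u' ∧ I.G.Adj u v ∧ u ∉ v :: l ∧ I.IsPath v t (v :: l) := by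
  simp only [IsPath, List.head?_cons, Option.some.injEq, List.getLast?_cons_cons,
    List.isChain_cons_cons, List.nodup_cons (a := u'), true_and]
  constructor
  · rintro ⟨rfl, h₂, ⟨h₃, h₄⟩, h₅, h₆⟩
    exact ⟨rfl, h₃, h₅, h₂, h₄, h₆⟩
  · rintro ⟨rfl, h₃, h₅, h₂, h₄, h₆⟩
    exact ⟨rfl, h₂, ⟨h₃, h₄⟩, h₅, h₆⟩

theorem IsPath.cons {u v t : Fin I.n} {P : List (Fin I.n)} (hP : I.IsPath v t P)
    (h : I.G.Adj u v) (hu : u ∉ P) :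
    I.IsPath u t (u :: P) ∧ I.pathLength (u :: P) = I.w u v + I.pathLength P := by
  obtain ⟨l, rfl⟩ := hP.exists_eq_cons
  exact ⟨isPath_cons_cons.2 ⟨rfl, h, hu, hP⟩, pathLength_cons_cons ..⟩

/-- Prepending an arc to a path gives a walk, which contains a path. -/
theorem IsPath.exists_isPath_of_adj {u v t : Fin I.n} {P : List (Fin I.n)} (hP : I.IsPath v t P)
    (h : I.G.Adj u v) :
    ∃ P', I.IsPath u t P' ∧ I.pathLength P' ≤ I.w u v + I.pathLength P := by
  by_cases hu : u ∈ P
  · obtain ⟨A, B, rfl⟩ := List.append_of_mem hu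
    refine ⟨u :: B, ⟨rfl, ?_, ?_, ?_⟩, (pathLength_le_append A B u).trans (by simp)⟩
    · have := hP.2.1
      rwa [List.getLast?_append_of_ne_nil _ (by simp)] at this
    · exact hP.2.2.1.suffix (List.suffix_append ..)
    · exact hP.2.2.2.sublist (List.sublist_append_right ..)
  · exact ⟨_, (hP.cons h hu).1, (hP.cons h hu).2.le⟩

/-- A shorter path from `v` would, with the arc from `u` in front, be a walk that contains a shorter
path from `u`. -/
theorem IsShortestPath.tail {u u' v t : Fin I.n} {l : List (Fin I.n)}
    (h : I.IsShortestPath u t (u' :: v :: l)) :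
    I.G.Adj u v ∧ I.IsShortestPath v t (v :: l) := by
  obtain ⟨rfl, h₁, -, h₂⟩ := isPath_cons_cons.1 h.1
  refine ⟨h₁, h₂, fun Q hQ => ?_⟩
  obtain ⟨P', hP', hle⟩ := hQ.exists_isPath_of_adj h₁
  have := (h.2 P' hP').trans hle
  rw [pathLength_cons_cons] at this
  exact le_of_add_le_add_left this

/-- `d` holds, at `u * n + t`, the distance from `u` to `t` whenever `t` can be reached. -/
structure IsDist (I : MVDSP) (d : ℕ → ℚ≥0) : Prop where
  le : ∀ (u t : Fin I.n) P, I.IsPath u t P → d (u * I.n + t) ≤ I.pathLength P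
  ge : ∀ (u t : Fin I.n) P, I.IsPath u t P →
    ∃ P', I.IsPath u t P' ∧ I.pathLength P' ≤ d (u * I.n + t)

theorem IsDist.eq {d : ℕ → ℚ≥0} (hd : I.IsDist d) {u t : Fin I.n} {P : List (Fin I.n)}
    (hP : I.IsShortestPath u t P) : d (u * I.n + t) = I.pathLength P := by
  obtain ⟨P', h₁, h₂⟩ := hd.ge u t P hP.1
  exact le_antisymm (hd.le u t P hP.1) ((hP.2 P' h₁).trans h₂)

/-- The states: `0` is the source, and the others stand for the triples of the number `J q` of
paths begun so far, the current pair `A q` and the current vertex `V q`. -/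
structure IsStateTable (I : MVDSP) (Q : ℕ) (J A V : ℕ → ℕ) : Prop where
  pos : 0 < Q
  source : J 0 = 0
  range : ∀ q < Q, q ≠ 0 → (1 ≤ J q ∧ J q ≤ I.p) ∧ A q < I.k ∧ V q < I.n
  surj : ∀ j < I.p, ∀ i < I.k, ∀ v < I.n, ∃ q < Q, q ≠ 0 ∧ J q = j + 1 ∧ A q = i ∧ V q = v

/-- The transitions between states. A path is traversed from its end to its start; when the start
is reached, the next path may be begun. -/
def Step (I : MVDSP) (d : ℕ → ℚ≥0) (J A V : ℕ → ℕ) (q' q : ℕ) : Prop :=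
  (J q = J q' ∧ 1 ≤ J q ∧ A q = A q' ∧ 1 ≤ I.input.arr 0 (V q * I.n + V q') ∧
    I.input.qarr 0 (V q * I.n + V q') + d (V q' * I.n + I.input.arr 2 (A q)) ≤
      d (V q * I.n + I.input.arr 2 (A q))) ∨
  (J q = J q' + 1 ∧ (J q' = 0 ∨ V q' = I.input.arr 1 (A q')) ∧ V q = I.input.arr 2 (A q))

/-- The states in which `p` paths are complete. -/
def Final (I : MVDSP) (J A V : ℕ → ℕ) (q : ℕ) : Prop :=
  J q = I.p ∧ (J q = 0 ∨ V q = I.input.arr 1 (A q))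

/-! ### Walks with distinct labels versus families of disjoint shortest paths. -/

section
variable {Q : ℕ} {J A V : ℕ → ℕ} {d : ℕ → ℚ≥0}

/-- A shortest path that avoids a family of disjoint shortest paths can be added to the family. -/
theorem exists_insert_path {S : Finset (Fin I.k)} {P : Fin I.k → List (Fin I.n)} {i : Fin I.k}
    {cur : List (Fin I.n)} (hS : ∀ i ∈ S, I.IsShortestPath (I.s i) (I.t i) (P i))
    (hdisj : ∀ i ∈ S, ∀ j ∈ S, i ≠ j → (P i).Disjoint (P j))
    (hcur : I.IsShortestPath (I.s i) (I.t i) cur) (hav : ∀ j ∈ S, ∀ x ∈ P j, x ∉ cur) :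
    ∃ (S' : Finset (Fin I.k)) (P' : Fin I.k → List (Fin I.n)), S'.card = S.card + 1 ∧
      (∀ i ∈ S', I.IsShortestPath (I.s i) (I.t i) (P' i)) ∧
      (∀ i ∈ S', ∀ j ∈ S', i ≠ j → (P' i).Disjoint (P' j)) ∧
      ∀ j ∈ S', ∀ x ∈ P' j, x ∈ cur ∨ ∃ j ∈ S, x ∈ P j := by
  -- A pair served before cannot come again, because its start would lie on both paths. This is why
  -- the states need not remember the used pairs.
  have hi : i ∉ S := by
    intro h
    obtain ⟨l, hl⟩ := (hS i h).1.exists_eq_cons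
    obtain ⟨l', rfl⟩ := hcur.1.exists_eq_cons
    exact hav i h (I.s i) (by simp [hl]) (by simp)
  have hne : ∀ j ∈ S, j ≠ i := fun j hj h => hi (h ▸ hj)
  have hself : Function.update P i cur i = cur := Function.update_self ..
  have hother : ∀ j ∈ S, Function.update P i cur j = P j := fun j hj =>
    Function.update_of_ne (hne j hj) ..
  refine ⟨insert i S, Function.update P i cur, Finset.card_insert_of_notMem hi, ?_, ?_, ?_⟩
  · intro j hj
    rcases Finset.mem_insert.1 hj with rfl | hj
    · rwa [hself]
    · rw [hother j hj]; exact hS j hj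
  · intro a ha b hb hab
    rcases Finset.mem_insert.1 ha with ha | ha <;> rcases Finset.mem_insert.1 hb with hb | hb
    · exact absurd (ha.trans hb.symm) hab
    · rw [ha, hself, hother b hb]
      exact fun x hx hx' => hav b hb x hx' hx
    · rw [hb, hself, hother a ha]
      exact fun x hx hx' => hav a ha x hx hx'
    · rw [hother a ha, hother b hb]
      exact hdisj a ha b hb hab
  · intro j hj x hx
    rcases Finset.mem_insert.1 hj with rfl | hj
    · rw [hself] at hx; exact .inl hx
    · rw [hother j hj] at hx; exact .inr ⟨j, hj, hx⟩

/-- The walk decodes into `J q - 1` completed disjoint paths and a current piece `cur`, a shortest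
path from the current vertex to the end of its pair. A step of the first kind prepends a vertex to
`cur`: the vertex is new because labels are distinct, and the distance inequality keeps the piece
shortest. A step of the second kind moves `cur`, if there is one, to the completed paths. -/
theorem walk_sound (hT : I.IsStateTable Q J A V) (hd : I.IsDist d) {r q : ℕ} {l : List ℕ}
    (hq : q < Q) (hl : l ∈ walkLabels Q (I.Step d J A V) V r q) (hn : l.Nodup) (hq0 : q ≠ 0) :
    ∃ (i : Fin I.k) (v : Fin I.n) (S : Finset (Fin I.k)) (P : Fin I.k → List (Fin I.n))
      (cur : List (Fin I.n)), A q = i ∧ V q = v ∧ S.card + 1 = J q ∧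
      (∀ i ∈ S, I.IsShortestPath (I.s i) (I.t i) (P i)) ∧
      (∀ i ∈ S, ∀ j ∈ S, i ≠ j → (P i).Disjoint (P j)) ∧
      I.IsShortestPath v (I.t i) cur ∧ (∀ x ∈ cur, (x : ℕ) ∈ l) ∧
      ∀ i ∈ S, ∀ x ∈ P i, x ∉ cur ∧ (x : ℕ) ∈ l := by
  induction r generalizing q l with
  | zero => simp [walkLabels, hq0] at hl
  | succ r ih =>
    simp only [walkLabels, List.mem_flatMap, List.mem_range] at hl
    obtain ⟨q', hq', hl⟩ := hl
    split_ifs at hl with hR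
    swap
    · simp at hl
    obtain ⟨l', hl', rfl⟩ := List.mem_map.1 hl
    obtain ⟨hv, hn'⟩ := List.nodup_cons.1 hn
    obtain ⟨hJ, hA, hV⟩ := hT.range q hq hq0
    obtain ⟨i, hi⟩ : ∃ i : Fin I.k, A q = i := ⟨⟨A q, hA⟩, rfl⟩
    obtain ⟨v, hv'⟩ : ∃ v : Fin I.n, V q = v := ⟨⟨V q, hV⟩, rfl⟩
    rw [hv'] at hv
    rcases hR with ⟨h1, h2, h3, h4, h5⟩ | ⟨h1, h2, h3⟩
    · have hq'0 : q' ≠ 0 := by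
        rintro rfl
        rw [hT.source] at h1
        omega
      obtain ⟨i', v', S, P, cur, e1, e2, e3, e4, e5, e6, e7, e8⟩ := ih hq' hl' hn' hq'0
      obtain rfl : i' = i := Fin.ext (by omega)
      rw [hv', e2] at h4 h5
      have hadj := one_le_input_arr_zero.1 h4
      rw [input_qarr_zero hadj, hi, input_arr_two, hd.eq e6] at h5
      -- All vertices of `cur` occur among the earlier labels, and the new label does not.
      have hvc : v ∉ cur := fun h => hv (e7 v h)
      obtain ⟨c1, c2⟩ := e6.1.cons hadj hvc
      refine ⟨i', v, S, P, v :: cur, hi, hv', by omega, e4, e5, ⟨c1, fun P' hP' => ?_⟩, ?_, ?_⟩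
      · rw [c2]
        exact h5.trans (hd.le _ _ _ hP')
      · intro x hx
        rcases List.mem_cons.1 hx with rfl | hx
        · simp [hv']
        · exact List.mem_cons_of_mem _ (e7 x hx)
      · intro i hi x hx
        obtain ⟨f1, f2⟩ := e8 i hi x hx
        refine ⟨fun h => ?_, List.mem_cons_of_mem _ f2⟩
        rcases List.mem_cons.1 h with rfl | h
        · exact hv f2
        · exact f1 h
    · rw [hi, input_arr_two, hv'] at h3
      obtain rfl : v = I.t i := Fin.ext h3
      by_cases hq'0 : q' = 0
      · subst hq'0
        rw [hT.source] at h1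
        refine ⟨i, I.t i, ∅, fun _ => [], [I.t i], hi, hv', by simp [h1], by simp, by simp,
          isShortestPath_singleton _, by simp [hv'], by simp⟩
      · obtain ⟨i', v', S, P, cur, e1, e2, e3, e4, e5, e6, e7, e8⟩ := ih hq' hl' hn' hq'0
        have h2 := h2.resolve_left (by omega)
        rw [e1, input_arr_one, e2] at h2
        obtain rfl : v' = I.s i' := Fin.ext h2
        obtain ⟨S', P', g1, g2, g3, g4⟩ :=
          exists_insert_path e4 e5 e6 fun j hj x hx => (e8 j hj x hx).1
        refine ⟨i, I.t i, S', P', [I.t i], hi, hv', by omega, g2, g3,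
          isShortestPath_singleton _, by simp [hv'], fun j hj x hx => ?_⟩
        have hx' : (x : ℕ) ∈ l' := by
          rcases g4 j hj x hx with h | ⟨j', hj', h⟩
          · exact e7 x h
          · exact (e8 j' hj' x h).2
        refine ⟨fun h => hv ?_, List.mem_cons_of_mem _ hx'⟩
        rw [List.mem_singleton] at h
        rwa [← h]

theorem isYes_of_walk (hT : I.IsStateTable Q J A V) (hd : I.IsDist d) {r q : ℕ} {l : List ℕ}
    (hq : q < Q) (hl : l ∈ walkLabels Q (I.Step d J A V) V r q) (hn : l.Nodup)
    (hf : I.Final J A V q) : I.IsYes := by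
  by_cases hq0 : q = 0
  · subst hq0
    have : I.p = 0 := by rw [← hf.1, hT.source]
    exact ⟨∅, fun _ => [], by simp [this], by simp, by simp⟩
  · obtain ⟨i, v, S, P, cur, e1, e2, e3, e4, e5, e6, e7, e8⟩ := walk_sound hT hd hq hl hn hq0
    have h2 := hf.2.resolve_left (by omega)
    rw [e1, input_arr_one, e2] at h2
    obtain rfl : v = I.s i := Fin.ext h2
    obtain ⟨S', P', g1, g2, g3, -⟩ :=
      exists_insert_path e4 e5 e6 fun j hj x hx => (e8 j hj x hx).1
    exact ⟨S', P', by rw [g1, e3, hf.1], g2, g3⟩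

theorem mem_walkLabels_succ {R : ℕ → ℕ → Prop} {lab : ℕ → ℕ} {r q q' : ℕ} {l : List ℕ}
    (hq' : q' < Q) (hR : R q' q) (hl : l ∈ walkLabels Q R lab r q') :
    lab q :: l ∈ walkLabels Q R lab (r + 1) q := by
  simp only [walkLabels, List.mem_flatMap, List.mem_range]
  exact ⟨q', hq', by simp [hR, hl]⟩

/-- Label sequences list the last label first and a path is walked from its end, so the vertices of
`cur` appear in their own order in front of `l`. Induction on `cur` walks the tail first, which is
again a shortest path. -/
theorem exists_walk_append (hT : I.IsStateTable Q J A V) (hd : I.IsDist d) {r q' : ℕ}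
    {l : List ℕ} (hq' : q' < Q) (hl : l ∈ walkLabels Q (I.Step d J A V) V r q')
    (hJ : J q' < I.p) (hE : J q' = 0 ∨ V q' = I.input.arr 1 (A q')) (i : Fin I.k)
    (cur : List (Fin I.n)) (v : Fin I.n) (hc : I.IsShortestPath v (I.t i) cur) :
    ∃ q < Q, J q = J q' + 1 ∧ A q = i ∧ V q = v ∧
      cur.map Fin.val ++ l ∈ walkLabels Q (I.Step d J A V) V (r + cur.length) q := by
  induction cur generalizing v with
  | nil => obtain ⟨l, hl⟩ := hc.1.exists_eq_cons; simp at hl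
  | cons u cur ih =>
    obtain ⟨q, hq, hq0, e1, e2, e3⟩ := hT.surj _ hJ i i.2 v v.2
    refine ⟨q, hq, e1, e2, e3, ?_⟩
    have huv : u = v := by have := hc.1.1; simpa using this
    cases cur with
    | nil =>
      have hvt : u = I.t i := by have := hc.1.2.1; simpa using this
      have := mem_walkLabels_succ (lab := V) (q := q) hq'
        (R := I.Step d J A V) (Or.inr ⟨e1, hE, by rw [e2, input_arr_two, e3, ← huv, hvt]⟩) hl
      simpa [e3, huv] using this
    | cons v' cur =>
      obtain ⟨hadj, hs⟩ := hc.tail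
      obtain ⟨q₁, hq₁, f1, f2, f3, f4⟩ := ih v' hs
      have := mem_walkLabels_succ (lab := V) (q := q) hq₁ (R := I.Step d J A V) (Or.inl
        ⟨by omega, by omega, by omega, ?_, ?_⟩) f4
      · simpa [e3, huv, add_assoc] using this
      · rw [e3, f3]; exact one_le_input_arr_zero.2 hadj
      · rw [e3, f3, input_qarr_zero hadj, e2, input_arr_two, hd.eq hs, hd.eq hc, huv,
          pathLength_cons_cons]

theorem exists_walk (hT : I.IsStateTable Q J A V) (hd : I.IsDist d)
    (P : Fin I.k → List (Fin I.n)) (S : Finset (Fin I.k)) (hcard : S.card ≤ I.p)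
    (hS : ∀ i ∈ S, I.IsShortestPath (I.s i) (I.t i) (P i))
    (hdisj : ∀ i ∈ S, ∀ j ∈ S, i ≠ j → (P i).Disjoint (P j)) :
    ∃ q < Q, J q = S.card ∧ (J q = 0 ∨ V q = I.input.arr 1 (A q)) ∧
      ∃ l ∈ walkLabels Q (I.Step d J A V) V (∑ i ∈ S, (P i).length) q, l.Nodup ∧
        ∀ x ∈ l, ∃ i ∈ S, ∃ y ∈ P i, x = y := by
  induction S using Finset.induction_on with
  | empty => exact ⟨0, hT.pos, by simp [hT.source], .inl hT.source, [], by simp [walkLabels]⟩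
  | insert i S hi ih =>
    rw [Finset.card_insert_of_notMem hi] at hcard
    obtain ⟨q', hq', f1, f2, l, f3, f4, f5⟩ := ih (by omega)
      (fun j hj => hS j (Finset.mem_insert_of_mem hj))
      (fun a ha b hb => hdisj a (Finset.mem_insert_of_mem ha) b (Finset.mem_insert_of_mem hb))
    have hPi := hS i (Finset.mem_insert_self ..)
    obtain ⟨q, hq, g1, g2, g3, g4⟩ := exists_walk_append hT hd hq' f3 (by omega) f2 i (P i) _ hPi
    refine ⟨q, hq, by rw [Finset.card_insert_of_notMem hi]; omega,
      .inr (by rw [g3, g2, input_arr_one]), (P i).map Fin.val ++ l, ?_, ?_, ?_⟩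
    · rw [Finset.sum_insert hi, add_comm]
      exact g4
    · refine List.nodup_append.2 ⟨hPi.1.2.2.2.map Fin.val_injective, f4, ?_⟩
      rintro x hx y hy rfl
      obtain ⟨z, hz, rfl⟩ := List.mem_map.1 hx
      obtain ⟨j, hj, z', hz', hzz⟩ := f5 _ hy
      obtain rfl := Fin.ext hzz
      exact hdisj i (Finset.mem_insert_self ..) j (Finset.mem_insert_of_mem hj)
        (fun h => hi (h ▸ hj)) hz hz'
    · intro x hx
      rcases List.mem_append.1 hx with hx | hx
      · obtain ⟨z, hz, rfl⟩ := List.mem_map.1 hx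
        exact ⟨i, Finset.mem_insert_self .., z, hz, rfl⟩
      · obtain ⟨j, hj, h⟩ := f5 x hx
        exact ⟨j, Finset.mem_insert_of_mem hj, h⟩

/-- Take a solution with `ℓ` arcs and keep exactly `p` of its paths; `m` is their total number of
vertices. Disjointness gives `m ≤ n`. Since `s i ≠ t i`, each path has an arc, hence at most twice
as many vertices as arcs. -/
theorem IsYes.exists_walk (h : I.IsYes) (hT : I.IsStateTable Q J A V) (hd : I.IsDist d) :
    ∃ m ≤ I.n, m ≤ 2 * I.ell ∧ ∃ q < Q, I.Final J A V q ∧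
      ∃ l ∈ walkLabels Q (I.Step d J A V) V m q, l.Nodup := by
  have hne : {m | ∃ S P, I.IsSolution S P ∧ I.numArcs S P = m}.Nonempty := by
    obtain ⟨S, P, hSP⟩ := h
    exact ⟨_, S, P, hSP, rfl⟩
  obtain ⟨S, P, ⟨h1, h2, h3⟩, h4⟩ := Nat.sInf_mem hne
  obtain ⟨S', hS', hcard⟩ := Finset.exists_subset_card_eq h1
  obtain ⟨q, hq, f1, f2, l, f3, f4, f5⟩ := MVDSP.exists_walk hT hd P S' hcard.le
    (fun i hi => h2 i (hS' hi)) (fun i hi j hj => h3 i (hS' hi) j (hS' hj))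
  refine ⟨_, ?_, ?_, q, hq, ⟨f1.trans hcard, f2⟩, l, f3, f4⟩
  · rw [← length_of_mem_walkLabels f3]
    have hsub : l.toFinset ⊆ Finset.range I.n := by
      intro x hx
      obtain ⟨i, -, y, -, rfl⟩ := f5 x (List.mem_toFinset.1 hx)
      exact Finset.mem_range.2 y.2
    simpa [List.toFinset_card_of_nodup f4] using Finset.card_le_card hsub
  · rw [ell, if_pos h, ← h4, numArcs, Finset.mul_sum]
    refine le_trans (Finset.sum_le_sum fun i hi => ?_) (Finset.sum_le_sum_of_subset hS')
    have hp := h2 i (hS' hi)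
    obtain ⟨l, hl⟩ := hp.1.exists_eq_cons
    have hlast := hp.1.2.1
    rw [hl] at hlast ⊢
    cases l with
    | nil => exact absurd (by simpa using hlast) (I.s_ne_t i)
    | cons => simp only [List.length_cons]; omega

end

end MVDSP

/-! ### The program: tables, distances and states -/

local notation "vN" => (0 : ℕ)
local notation "vK" => (1 : ℕ)
local notation "vP" => (2 : ℕ)
local notation "vStates" => (4 : ℕ)
local notation "aAdj" => (0 : ℕ)
local notation "aRow" => (3 : ℕ)
local notation "aReach" => (4 : ℕ)
local notation "aJ" => (5 : ℕ)
local notation "aPair" => (6 : ℕ)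
local notation "aVert" => (7 : ℕ)
local notation "qW" => (0 : ℕ)
local notation "qDist" => (1 : ℕ)

namespace RAM

section
variable {N : ℕ} {σ : State} {Q : State → Prop}

theorem Exec.seq' {c d : Prog} {Q' : State → Prop} (hc : Exec N c σ Q')
    (hd : ∀ τ, Agree c σ τ → Q' τ → Exec N d τ Q) : Exec N (.seq c d) σ Q :=
  .seq (hc.mono hd)

theorem Agree.setVar {c : Prog} {τ : State} {x v : ℕ} (h : Agree c σ τ) (hx : c.wv x = true) :
    Agree c σ (τ.setVar x v) := by
  refine ⟨fun y hy => ?_, h.arr, h.qarr⟩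
  have hne : y ≠ x := by rintro rfl; simp [hx] at hy
  rw [State.setVar_var, if_neg hne, h.var y hy]

end

/-- Fill the array `dst` with the first `cnt` multiples of `e`. -/
def mulTable (dst : ℕ) (cnt e : NExp) : Prog :=
  .seq (.set 15 (.lit 0)) (.forLoop 14 cnt
    (.seq (.put dst (.var 14) (.var 15)) (.set 15 (.add (.var 15) e))))

/-- The machine cannot multiply, so the offsets of matrix rows and of table blocks are accumulated
by addition. -/
theorem exec_mulTable {N : ℕ} {σ : State} {dst M E : ℕ} {cnt e : NExp} (hM : M ≤ N)
    (hcnt : ∀ τ, Agree (mulTable dst cnt e) σ τ → cnt.eval τ = M)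
    (he : ∀ τ, Agree (mulTable dst cnt e) σ τ → e.eval τ = E) :
    Exec N (mulTable dst cnt e) σ (fun τ => ∀ i < M, τ.arr dst i = i * E) := by
  refine .seq (.set ?_)
  have hag : ∀ {τ}, Agree (.forLoop 14 cnt
      (.seq (.put dst (.var 14) (.var 15)) (.set 15 (.add (.var 15) e))))
      (σ.setVar 15 ((NExp.lit 0).eval σ)) τ → Agree (mulTable dst cnt e) σ τ := fun h =>
    (Agree.setVar .rfl (by simp [mulTable, Prog.wv])).trans h.seq_right
  refine .forLoop (fun i τ => τ.var 15 = i * E ∧ ∀ j < i, τ.arr dst j = j * E) hM rfl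
    (fun τ h => hcnt τ (hag h)) (fun i τ v h => by simpa using h) (by simp) ?_
    (fun τ _ h => h.2)
  intro i _ τ hτ hi hInv
  refine .seq (.put (.set ⟨?_, fun j hj => ?_⟩))
  · have : e.eval (τ.setArr dst i (i * E)) = E := by
      refine he _ ⟨fun x hx => (hag hτ).var x hx, fun x hx => ?_, fun x hx => (hag hτ).qarr x hx⟩
      have hne : x ≠ dst := by
        rintro rfl
        simp [mulTable, Prog.forLoop, Prog.wa] at hx
      rw [State.setArr_arr, if_neg hne, (hag hτ).arr x hx]
    simp [hi, hInv.1, this]; ring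
  · rcases Nat.lt_succ_iff_lt_or_eq.1 hj with hj | rfl
    · simp [hi, hj.ne, hInv.2 j hj]
    · simp [hi, hInv.1]

/-! ### All-pairs distances by rounds of relaxations. -/

/-- The index of the entry in row `u` and column `v` of an `n × n` matrix. -/
def entry (u v : NExp) : NExp := .add (.get aRow u) v

/-- Use the arc from `u` to `v` to improve the distance from `u` to `t`. -/
def relax : Prog :=
  .ite (.and (.le (.lit 1) (.get aAdj (entry (.var 11) (.var 12))))
      (.and (.le (.lit 1) (.get aReach (entry (.var 12) (.var 13))))
        (.or (.lt (.get aReach (entry (.var 11) (.var 13))) (.lit 1))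
          (.qle (.add (.get qW (entry (.var 11) (.var 12)))
            (.get qDist (entry (.var 12) (.var 13))))
            (.get qDist (entry (.var 11) (.var 13)))))))
    (.seq (.qput qDist (entry (.var 11) (.var 13))
        (.add (.get qW (entry (.var 11) (.var 12))) (.get qDist (entry (.var 12) (.var 13)))))
      (.put aReach (entry (.var 11) (.var 13)) (.lit 1)))
    .skip

/-- One round of relaxations. -/
def relaxAll : Prog :=
  .forLoop 11 (.var vN) (.forLoop 12 (.var vN) (.forLoop 13 (.var vN) relax))

/-- All distances. -/
def distances : Prog :=
  .seq (mulTable aRow (.var vN) (.var vN))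
    (.seq (.forLoop 10 (.var vN) (.put aReach (entry (.var 10) (.var 10)) (.lit 1)))
      (.forLoop 10 (.var vN) relaxAll))

/-- The memory contains the instance and the row table. -/
structure HasInput (I : MVDSP) (σ : State) : Prop where
  n : σ.var vN = I.n
  k : σ.var vK = I.k
  p : σ.var vP = I.p
  adj : σ.arr 0 = I.input.arr 0
  s : σ.arr 1 = I.input.arr 1
  t : σ.arr 2 = I.input.arr 2
  w : σ.qarr 0 = I.input.qarr 0
  row : ∀ v < I.n, σ.arr aRow v = v * I.n

/-- The program does not touch what `HasInput` speaks about. -/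
def Prog.keepsInput (c : Prog) : Bool :=
  !c.wv 0 && !c.wv 1 && !c.wv 2 && !c.wa 0 && !c.wa 1 && !c.wa 2 && !c.wa 3 && !c.wqa 0

theorem HasInput.agree {I : MVDSP} {σ τ : State} {c : Prog} (h : HasInput I σ)
    (hag : Agree c σ τ) (hc : c.keepsInput = true) : HasInput I τ := by
  simp only [Prog.keepsInput, Bool.and_eq_true, Bool.not_eq_true'] at hc
  obtain ⟨⟨⟨⟨⟨⟨⟨h1, h2⟩, h3⟩, h4⟩, h5⟩, h6⟩, h7⟩, h8⟩ := hc
  refine ⟨?_, ?_, ?_, ?_, ?_, ?_, ?_, ?_⟩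
  · rw [hag.var _ h1, h.n]
  · rw [hag.var _ h2, h.k]
  · rw [hag.var _ h3, h.p]
  · rw [hag.arr _ h4, h.adj]
  · rw [hag.arr _ h5, h.s]
  · rw [hag.arr _ h6, h.t]
  · rw [hag.qarr _ h8, h.w]
  · rw [hag.arr _ h7]; exact h.row

/-- Finite entries of the distance table are bounded below by lengths of paths. -/
def DistSound (I : MVDSP) (f : ℕ → ℕ) (d : ℕ → ℚ≥0) : Prop :=
  ∀ u t : Fin I.n, 1 ≤ f (u * I.n + t) →
    ∃ P, I.IsPath u t P ∧ I.pathLength P ≤ d (u * I.n + t)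

/-- The distance table accounts for all paths with at most `r + 1` vertices. -/
def DistComplete (I : MVDSP) (r : ℕ) (f : ℕ → ℕ) (d : ℕ → ℚ≥0) : Prop :=
  ∀ (u t : Fin I.n) P, I.IsPath u t P → P.length ≤ r + 1 →
    1 ≤ f (u * I.n + t) ∧ d (u * I.n + t) ≤ I.pathLength P

/-- The progress within one round, after the triples that precede `(a, b, c)` have been dealt
with. -/
structure RoundInv (I : MVDSP) (f₀ : ℕ → ℕ) (d₀ : ℕ → ℚ≥0) (a b c : ℕ) (f : ℕ → ℕ) (d : ℕ → ℚ≥0) :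
    Prop where
  sound : DistSound I f d
  mono : ∀ u t : Fin I.n, 1 ≤ f₀ (u * I.n + t) →
    1 ≤ f (u * I.n + t) ∧ d (u * I.n + t) ≤ d₀ (u * I.n + t)
  improved : ∀ u v t : Fin I.n, ((u : ℕ) < a ∨ (u : ℕ) = a ∧ ((v : ℕ) < b ∨ (v : ℕ) = b ∧ (t : ℕ) < c)) →
    I.G.Adj u v → 1 ≤ f₀ (v * I.n + t) →
    1 ≤ f (u * I.n + t) ∧ d (u * I.n + t) ≤ I.w u v + d₀ (v * I.n + t)

theorem matrix_index_inj {n : ℕ} {u t u' t' : Fin n} (h : (u : ℕ) * n + t = u' * n + t') :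
    u = u' ∧ t = t' := by
  have h1 : finProdFinEquiv (u, t) = finProdFinEquiv (u', t') := by
    ext; simp only [finProdFinEquiv_apply_val]; nlinarith
  simpa using finProdFinEquiv.injective h1

/-- Relaxation works in place: entries that are finite only decrease (`hmono`), so earlier
improvements persist, and using the current entry for `v` instead of the one from the start of the
round can only help. The new value is still bounded below by the length of a path, as a walk
contains a path. -/
theorem RoundInv.update {I : MVDSP} {f₀ f : ℕ → ℕ} {d₀ d : ℕ → ℚ≥0} {u v t : Fin I.n}
    (h : RoundInv I f₀ d₀ u v t f d) (hadj : I.G.Adj u v) (hf : 1 ≤ f (v * I.n + t))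
    (hlt : f (u * I.n + t) < 1 ∨ I.w u v + d (v * I.n + t) ≤ d (u * I.n + t)) :
    RoundInv I f₀ d₀ u v (t + 1) (Function.update f (u * I.n + t) 1)
      (Function.update d (u * I.n + t) (I.w u v + d (v * I.n + t))) := by
  have hmono : ∀ u' t' : Fin I.n, 1 ≤ f (u' * I.n + t') →
      1 ≤ Function.update f (u * I.n + t) 1 (u' * I.n + t') ∧
        Function.update d (u * I.n + t) (I.w u v + d (v * I.n + t)) (u' * I.n + t') ≤
          d (u' * I.n + t') := by
    intro u' t' hf'
    by_cases he : (u' : ℕ) * I.n + t' = u * I.n + t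
    · rw [he] at hf' ⊢
      simp only [Function.update_self, le_refl, true_and]
      exact hlt.resolve_left (by omega)
    · simp [he, hf']
  refine ⟨?_, ?_, ?_⟩
  · intro u' t' hf'
    by_cases he : (u' : ℕ) * I.n + t' = u * I.n + t
    · obtain ⟨rfl, rfl⟩ := matrix_index_inj he
      obtain ⟨P, hP, hle⟩ := h.sound v t' hf
      obtain ⟨P', hP', hle'⟩ := hP.exists_isPath_of_adj hadj
      refine ⟨P', hP', ?_⟩
      rw [Function.update_self]
      exact hle'.trans (by gcongr)
    · simp only [ne_eq, he, not_false_eq_true, Function.update_of_ne] at hf' ⊢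
      exact h.sound u' t' hf'
  · intro u' t' hf'
    obtain ⟨h1, h2⟩ := h.mono u' t' hf'
    obtain ⟨h3, h4⟩ := hmono u' t' h1
    exact ⟨h3, h4.trans h2⟩
  · intro u' v' t' hlex hadj' hf'
    by_cases he : u' = u ∧ v' = v ∧ t' = t
    · obtain ⟨rfl, rfl, rfl⟩ := he
      simp only [Function.update_self, le_refl, true_and]
      gcongr
      exact (h.mono v' t' hf').2
    · have : (u' : ℕ) < u ∨ (u' : ℕ) = u ∧ ((v' : ℕ) < v ∨ (v' : ℕ) = v ∧ (t' : ℕ) < t) := by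
        simp only [Fin.ext_iff] at he
        omega
      obtain ⟨h1, h2⟩ := h.improved u' v' t' this hadj' hf'
      obtain ⟨h3, h4⟩ := hmono u' t' h1
      exact ⟨h3, h4.trans h2⟩

theorem RoundInv.skip {I : MVDSP} {f₀ f : ℕ → ℕ} {d₀ d : ℕ → ℚ≥0} {u v t : Fin I.n}
    (h : RoundInv I f₀ d₀ u v t f d)
    (hno : ¬ (I.G.Adj u v ∧ 1 ≤ f (v * I.n + t) ∧
      (f (u * I.n + t) < 1 ∨ I.w u v + d (v * I.n + t) ≤ d (u * I.n + t)))) :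
    RoundInv I f₀ d₀ u v (t + 1) f d := by
  refine ⟨h.sound, h.mono, fun u' v' t' hlex hadj' hf' => ?_⟩
  by_cases he : u' = u ∧ v' = v ∧ t' = t
  · obtain ⟨rfl, rfl, rfl⟩ := he
    obtain ⟨h1, h2⟩ := h.mono v' t' hf'
    obtain ⟨h3, h4⟩ := not_or.1 fun h' => hno ⟨hadj', h1, h'⟩
    exact ⟨not_lt.1 h3, (not_le.1 h4).le.trans (by gcongr)⟩
  · refine h.improved u' v' t' ?_ hadj' hf'
    simp only [Fin.ext_iff] at he
    omega

theorem exec_relax {I : MVDSP} {N : ℕ} {σ : State} {f₀ : ℕ → ℕ} {d₀ : ℕ → ℚ≥0} {u v t : Fin I.n}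
    (hI : HasInput I σ) (hu : σ.var 11 = u) (hv : σ.var 12 = v) (ht : σ.var 13 = t)
    (h : RoundInv I f₀ d₀ u v t (σ.arr aReach) (σ.qarr qDist)) :
    Exec N relax σ (fun τ => RoundInv I f₀ d₀ u v (t + 1) (τ.arr aReach) (τ.qarr qDist)) := by
  have hru := hI.row u u.2
  have hrv := hI.row v v.2
  have hadj : 1 ≤ σ.arr 0 (u * I.n + v) ↔ I.G.Adj u v := by
    rw [hI.adj, MVDSP.one_le_input_arr_zero]
  refine .ite (fun hb => ?_) (fun hb => ?_)
  · simp only [entry, BExp.holds_and, BExp.holds_le, BExp.holds_or, BExp.holds_lt, BExp.holds_qle,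
      NExp.eval, QExp.eval, hu, hv, ht, hru, hrv, hadj] at hb
    obtain ⟨h1, h2, h3⟩ := hb
    have hw : σ.qarr 0 (u * I.n + v) = I.w u v := by rw [hI.w, MVDSP.input_qarr_zero h1]
    rw [hw] at h3
    refine .seq (.qput (.put ?_))
    simp only [entry, NExp.eval, QExp.eval, State.setArr_arr, State.setQArr_arr,
      State.setArr_qarr, State.setQArr_qarr, State.setQArr_var, if_true, hu, hv, ht, hru, hrv, hw]
    exact h.update h1 h2 h3
  · refine .skip (h.skip fun ⟨h1, h2, h3⟩ => hb ?_)
    have hw : σ.qarr 0 (u * I.n + v) = I.w u v := by rw [hI.w, MVDSP.input_qarr_zero h1]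
    simp only [entry, BExp.holds_and, BExp.holds_le, BExp.holds_or, BExp.holds_lt, BExp.holds_qle,
      NExp.eval, QExp.eval, hu, hv, ht, hru, hrv, hadj, hw]
    exact ⟨h1, h2, h3⟩

theorem exec_relaxAll {I : MVDSP} {N : ℕ} {σ : State} (hN : I.n ≤ N) (hI : HasInput I σ)
    (hs : DistSound I (σ.arr aReach) (σ.qarr qDist)) :
    Exec N relaxAll σ (fun τ =>
      RoundInv I (σ.arr aReach) (σ.qarr qDist) I.n 0 0 (τ.arr aReach) (τ.qarr qDist)) := by
  refine .forLoop (fun i τ =>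
      RoundInv I (σ.arr aReach) (σ.qarr qDist) i 0 0 (τ.arr aReach) (τ.qarr qDist)) hN rfl
    (fun τ h => by simpa using (hI.agree h (by decide)).n) (fun _ _ _ h => h)
    ⟨hs, fun _ _ h => ⟨h, le_rfl⟩, fun _ _ _ h => by omega⟩ ?_ (fun _ _ h => h)
  intro u hu τ₁ ag₁ hu₁ inv₁
  have hI₁ := hI.agree ag₁ (by decide)
  refine .forLoop (fun i τ =>
      RoundInv I (σ.arr aReach) (σ.qarr qDist) u i 0 (τ.arr aReach) (τ.qarr qDist)) hN rfl
    (fun τ h => by simpa using (hI₁.agree h (by decide)).n) (fun _ _ _ h => h) inv₁ ?_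
    (fun _ _ h => ⟨h.sound, h.mono, fun u' v' t' hlex => h.improved u' v' t' (by omega)⟩)
  intro v hv τ₂ ag₂ hv₂ inv₂
  have hI₂ := hI₁.agree ag₂ (by decide)
  have hu₂ : τ₂.var 11 = u := (ag₂.var 11 (by decide)).trans hu₁
  refine .forLoop (fun i τ =>
      RoundInv I (σ.arr aReach) (σ.qarr qDist) u v i (τ.arr aReach) (τ.qarr qDist)) hN rfl
    (fun τ h => by simpa using (hI₂.agree h (by decide)).n) (fun _ _ _ h => h) inv₂ ?_
    (fun _ _ h => ⟨h.sound, h.mono, fun u' v' t' hlex => h.improved u' v' t' (by omega)⟩)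
  intro t ht τ₃ ag₃ ht₃ inv₃
  exact exec_relax (u := ⟨u, hu⟩) (v := ⟨v, hv⟩) (t := ⟨t, ht⟩) (hI₂.agree ag₃ (by decide))
    ((ag₃.var 11 (by decide)).trans hu₂) ((ag₃.var 12 (by decide)).trans hv₂) ht₃ inv₃

/-- A path with one more vertex is an arc followed by a path already accounted for. -/
theorem RoundInv.complete {I : MVDSP} {f₀ f : ℕ → ℕ} {d₀ d : ℕ → ℚ≥0} {r : ℕ}
    (h : RoundInv I f₀ d₀ I.n 0 0 f d) (hc : DistComplete I r f₀ d₀) :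
    DistComplete I (r + 1) f d := by
  intro u t P hP hlen
  obtain ⟨l, rfl⟩ := hP.exists_eq_cons
  cases l with
  | nil =>
    obtain ⟨h1, h2⟩ := hc u t _ hP (by simp)
    exact ⟨(h.mono u t h1).1, (h.mono u t h1).2.trans h2⟩
  | cons v l =>
    obtain ⟨-, hadj, -, hP'⟩ := MVDSP.isPath_cons_cons.1 hP
    obtain ⟨h1, h2⟩ := hc v t _ hP' (by simpa using hlen)
    obtain ⟨h3, h4⟩ := h.improved u v t (.inl u.2) hadj h1
    refine ⟨h3, h4.trans ?_⟩
    rw [MVDSP.pathLength_cons_cons]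
    gcongr

theorem exec_distances {I : MVDSP} {N : ℕ} (hN : I.n ≤ N) :
    Exec N distances I.input (fun τ => HasInput I τ ∧ I.IsDist (τ.qarr qDist)) := by
  refine .seq' (exec_mulTable (M := I.n) (E := I.n) hN (fun τ h => ?_) (fun τ h => ?_)) ?_
  · simpa [MVDSP.input] using h.var 0 (by decide)
  · simpa [MVDSP.input] using h.var 0 (by decide)
  intro τ ag hrow
  have hI : HasInput I τ := by
    refine ⟨?_, ?_, ?_, ?_, ?_, ?_, ?_, hrow⟩
    · rw [ag.var 0 (by decide)]; simp [MVDSP.input]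
    · rw [ag.var 1 (by decide)]; simp [MVDSP.input]
    · rw [ag.var 2 (by decide)]; simp [MVDSP.input]
    · rw [ag.arr 0 (by decide)]
    · rw [ag.arr 1 (by decide)]
    · rw [ag.arr 2 (by decide)]
    · rw [ag.qarr 0 (by decide)]
  -- Untouched memory is zero: no pair counts as reachable yet, and the distance of each vertex to
  -- itself is already right.
  have hr0 : ∀ i, τ.arr aReach i = 0 := fun i => by rw [ag.arr 4 (by decide)]; simp [MVDSP.input]
  have hd0 : ∀ i, τ.qarr qDist i = 0 := fun i => by rw [ag.qarr 1 (by decide)]; simp [MVDSP.input]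
  refine .seq' (Q' := fun τ => DistSound I (τ.arr aReach) (τ.qarr qDist) ∧
    DistComplete I 0 (τ.arr aReach) (τ.qarr qDist)) ?_ ?_
  · refine .forLoop (fun i υ => DistSound I (υ.arr aReach) (fun _ => 0) ∧
        ∀ u : Fin I.n, (u : ℕ) < i → υ.arr aReach (u * I.n + u) = 1) hN rfl
      (fun υ h => by simpa using (hI.agree h (by decide)).n) (fun _ _ _ h => h)
      ⟨fun u t h => by simp [hr0] at h, fun u h => by omega⟩ ?_ ?_
    · intro i hi υ ag' hi' inv
      refine .put ?_
      have hrow' := (hI.agree ag' (by decide)).row i hi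
      simp only [entry, NExp.eval, State.setArr_arr, if_true, hi', hrow']
      refine ⟨fun u t h => ?_, fun u hu => ?_⟩
      · by_cases he : (u : ℕ) * I.n + t = (⟨i, hi⟩ : Fin I.n) * I.n + (⟨i, hi⟩ : Fin I.n)
        · obtain ⟨rfl, rfl⟩ := matrix_index_inj he
          exact ⟨_, MVDSP.isPath_singleton _, by simp [MVDSP.pathLength]⟩
        · rw [Function.update_of_ne he] at h
          exact inv.1 u t h
      · by_cases he : (u : ℕ) = i
        · simp [he]
        · rw [Function.update_of_ne]
          · exact inv.2 u (by omega)
          · intro h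
            exact he (congrArg Fin.val (matrix_index_inj (u' := ⟨i, hi⟩) (t' := ⟨i, hi⟩) h).1)
    · intro υ ag' inv
      have hd : υ.qarr qDist = fun _ => 0 := by
        rw [ag'.qarr 1 (by decide)]; exact funext hd0
      rw [hd]
      refine ⟨inv.1, fun u t P hP hlen => ?_⟩
      obtain ⟨l, rfl⟩ := hP.exists_eq_cons
      obtain rfl : l = [] := by simpa using hlen
      obtain rfl : u = t := by simpa using hP.2.1
      exact ⟨(inv.2 u u.2).ge, by simp⟩
  · intro υ ag' ⟨hs, hc⟩
    have hIυ := hI.agree ag' (by decide)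
    refine .forLoop (fun i ω => DistSound I (ω.arr aReach) (ω.qarr qDist) ∧
        DistComplete I i (ω.arr aReach) (ω.qarr qDist)) hN rfl
      (fun ω h => by simpa using (hIυ.agree h (by decide)).n) (fun _ _ _ h => h) ⟨hs, hc⟩ ?_ ?_
    · intro i hi ω ag'' _ inv
      exact (exec_relaxAll hN (hIυ.agree ag'' (by decide)) inv.1).mono fun _ _ h =>
        ⟨h.sound, h.complete inv.2⟩
    · intro ω ag'' inv
      -- The vertices of a path are distinct, so `n` rounds account for all paths.
      have hlen : ∀ {u t : Fin I.n} {P}, I.IsPath u t P → P.length ≤ I.n + 1 := fun hP => by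
        have := hP.2.2.2.length_le_card
        simp at this
        omega
      exact ⟨hIυ.agree ag'' (by decide), fun u t P hP => (inv.2 u t P hP (hlen hP)).2,
        fun u t P hP => inv.1 u t (inv.2 u t P hP (hlen hP)).1⟩

/-! ### Enumeration of the states. -/

/-- Append the state `(j + 1, i, v)` to the state table. -/
def addState : Prog :=
  .seq (.put aJ (.var vStates) (.add (.var 16) (.lit 1)))
    (.seq (.put aPair (.var vStates) (.var 17)) (.seq (.put aVert (.var vStates) (.var 18))
      (.set vStates (.add (.var vStates) (.lit 1)))))

/-- The state table. -/
def states : Prog :=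
  .seq (.set vStates (.lit 1))
    (.forLoop 16 (.var vP) (.forLoop 17 (.var vK) (.forLoop 18 (.var vN) addState)))

/-- The state table contains the triples that precede `(a, b, c)`. -/
structure StatesInv (I : MVDSP) (a b c : ℕ) (σ : State) : Prop where
  count : σ.var vStates = 1 + (a * I.k + b) * I.n + c
  source : σ.arr aJ 0 = 0
  range : ∀ q < σ.var vStates, q ≠ 0 → (1 ≤ σ.arr aJ q ∧ σ.arr aJ q ≤ I.p) ∧
    σ.arr aPair q < I.k ∧ σ.arr aVert q < I.n
  surj : ∀ j < I.p, ∀ i < I.k, ∀ v < I.n, (j < a ∨ j = a ∧ (i < b ∨ i = b ∧ v < c)) →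
    ∃ q < σ.var vStates, q ≠ 0 ∧ σ.arr aJ q = j + 1 ∧ σ.arr aPair q = i ∧ σ.arr aVert q = v

theorem exec_addState {I : MVDSP} {N : ℕ} {σ : State} {a b c : ℕ} (ha : a < I.p) (hb : b < I.k)
    (hc : c < I.n) (ha' : σ.var 16 = a) (hb' : σ.var 17 = b) (hc' : σ.var 18 = c)
    (h : StatesInv I a b c σ) : Exec N addState σ (StatesInv I a b (c + 1)) := by
  refine .seq (.put (.seq (.put (.seq (.put (.set ?_))))))
  have hpos : 0 ≠ σ.var vStates := by rw [h.count]; omega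
  refine ⟨?_, ?_, ?_, ?_⟩
  · simp [h.count]; ring
  · simp [hpos, h.source]
  · intro q hq hq0
    simp only [NExp.eval, State.setVar_var, State.setArr_var, if_true] at hq
    rcases Nat.lt_succ_iff_lt_or_eq.1 hq with hq | rfl
    · simpa [hq.ne] using h.range q hq hq0
    · simp [ha', hb', hc', hb, hc]; omega
  · intro j hj i hi v hv hlex
    by_cases he : j = a ∧ i = b ∧ v = c
    · refine ⟨σ.var vStates, by simp, hpos.symm, ?_⟩
      simp [ha', hb', hc', he]
    · obtain ⟨q, hq, hq0, h1, h2, h3⟩ := h.surj j hj i hi v hv (by omega)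
      refine ⟨q, by simp; omega, hq0, ?_⟩
      simp [hq.ne, h1, h2, h3]

theorem exec_states {I : MVDSP} {N : ℕ} {σ : State} (hn : I.n ≤ N) (hk : I.k ≤ N) (hp : I.p ≤ N)
    (hI : HasInput I σ) (h0 : σ.arr aJ 0 = 0) :
    Exec N states σ (fun τ => τ.var vStates = 1 + I.p * I.k * I.n ∧
      I.IsStateTable (τ.var vStates) (τ.arr aJ) (τ.arr aPair) (τ.arr aVert)) := by
  -- The count starts at `1`: index `0` is the source, whose entry in `aJ` is the zero that was
  -- there before.
  refine .seq (.set ?_)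
  have hI₀ : HasInput I (σ.setVar vStates ((NExp.lit 1).eval σ)) :=
    ⟨hI.n, hI.k, hI.p, hI.adj, hI.s, hI.t, hI.w, hI.row⟩
  refine .forLoop (fun i τ => StatesInv I i 0 0 τ) hp rfl
    (fun τ h => by simpa using (hI₀.agree h (by decide)).p)
    (fun _ _ _ h => ⟨h.count, h.source, h.range, h.surj⟩)
    ⟨by simp, h0, fun q hq hq0 => ?_, by omega⟩ ?_ ?_
  · simp at hq; omega
  · intro a ha τ₁ ag₁ ha₁ inv₁
    have hI₁ := hI₀.agree ag₁ (by decide)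
    refine .forLoop (fun i τ => StatesInv I a i 0 τ) hk rfl
      (fun τ h => by simpa using (hI₁.agree h (by decide)).k)
      (fun _ _ _ h => ⟨h.count, h.source, h.range, h.surj⟩) inv₁ ?_
      (fun _ _ h => ⟨by rw [h.count]; ring, h.source, h.range, fun j hj i hi v hv hlex =>
        h.surj j hj i hi v hv (by omega)⟩)
    intro b hb τ₂ ag₂ hb₂ inv₂
    have hI₂ := hI₁.agree ag₂ (by decide)
    have ha₂ : τ₂.var 16 = a := (ag₂.var 16 (by decide)).trans ha₁
    refine .forLoop (fun i τ => StatesInv I a b i τ) hn rfl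
      (fun τ h => by simpa using (hI₂.agree h (by decide)).n)
      (fun _ _ _ h => ⟨h.count, h.source, h.range, h.surj⟩) inv₂ ?_
      (fun _ _ h => ⟨by rw [h.count]; ring, h.source, h.range, fun j hj i hi v hv hlex =>
        h.surj j hj i hi v hv (by omega)⟩)
    intro c hc τ₃ ag₃ hc₃ inv₃
    exact exec_addState ha hb hc ((ag₃.var 16 (by decide)).trans ha₂)
      ((ag₃.var 17 (by decide)).trans hb₂) hc₃ inv₃
  · intro τ ag inv
    refine ⟨by rw [inv.count]; ring, by rw [inv.count]; omega, inv.source, inv.range,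
      fun j hj i hi v hv => inv.surj j hj i hi v hv (.inl hj)⟩

end RAM

/-! ### The program: evaluating the sum over walks -/

local notation "vRes" => (3 : ℕ)
local notation "vM" => (5 : ℕ)
local notation "aPow" => (8 : ℕ)
local notation "aBase" => (9 : ℕ)
local notation "aPos" => (10 : ℕ)
local notation "aNeg" => (11 : ℕ)
local notation "vY" => (20 : ℕ)
local notation "vX" => (21 : ℕ)
local notation "vZ" => (22 : ℕ)
local notation "vQ" => (23 : ℕ)
local notation "vB" => (25 : ℕ)
local notation "vParB" => (27 : ℕ)
local notation "vA" => (29 : ℕ)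
local notation "vParA" => (31 : ℕ)
local notation "vPred" => (32 : ℕ)
local notation "vTPos" => (35 : ℕ)
local notation "vTNeg" => (36 : ℕ)
local notation "vUPos" => (37 : ℕ)
local notation "vUNeg" => (38 : ℕ)
local notation "vAccPos" => (39 : ℕ)
local notation "vAccNeg" => (40 : ℕ)
local notation "vIdx" => (41 : ℕ)

namespace RAM

/-- Run `body` for all positions `a` of ones in the binary expansion of `src`, from high to low,
where `par` is, up to the initial value `par₀`, the parity of the number of higher ones. -/
def bitLoop (i a r par : ℕ) (src par₀ : NExp) (body : Prog) : Prog :=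
  .seq (.set r src) (.seq (.set par par₀) (.forLoop i (.var vM)
    (.seq (.set a (.sub (.var vM) (.add (.var i) (.lit 1))))
      (.ite (.le (.get aPow (.var a)) (.var r))
        (.seq (.set r (.sub (.var r) (.get aPow (.var a))))
          (.seq body (.set par (.sub (.lit 1) (.var par)))))
        .skip))))

theorem filter_le_eq_insert {S : Finset ℕ} {b : ℕ} (hb : b ∈ S) :
    S.filter (b ≤ ·) = insert b (S.filter (b + 1 ≤ ·)) := by
  ext x
  simp only [Finset.mem_filter, Finset.mem_insert]
  constructor
  · rintro ⟨h, h'⟩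
    rcases h'.eq_or_lt with rfl | h'
    · exact .inl rfl
    · exact .inr ⟨h, h'⟩
  · rintro (rfl | ⟨h, h'⟩)
    · exact ⟨hb, le_rfl⟩
    · exact ⟨h, by omega⟩

theorem filter_le_eq_of_notMem {S : Finset ℕ} {b : ℕ} (hb : b ∉ S) :
    S.filter (b ≤ ·) = S.filter (b + 1 ≤ ·) := by
  ext x
  simp only [Finset.mem_filter]
  refine and_congr_right fun h => ⟨fun h' => ?_, fun h' => by omega⟩
  rcases h'.eq_or_lt with rfl | h'
  · exact absurd h hb
  · exact h'

/-- `F` is the integer being accumulated and `g b` the contribution of the one at `b`. Ones are met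
from high to low, so the number met before `b` is the exponent in `rowSign`, and `par` keeps its
parity. In round `j` the word `r` holds `X % 2 ^ (m - j)`. The initial parity `p₀` lets an inner
loop inherit the sign of an outer one. -/
theorem exec_bitLoop {N : ℕ} {σ : State} {i a r par m X p₀ : ℕ} {src par₀ : NExp} {body : Prog}
    (F : State → ℤ) (g : ℕ → ℤ) (hN : m ≤ N) (hX : X < 2 ^ m) (hp₀ : p₀ ≤ 1)
    (hne : [i, a, r, par, vM].Nodup)
    (hbv : body.wv i = false ∧ body.wv a = false ∧ body.wv r = false ∧ body.wv par = false ∧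
      body.wv vM = false ∧ body.wa aPow = false)
    (hm : σ.var vM = m) (hpow : ∀ a < m, σ.arr aPow a = 2 ^ a)
    (hsrc : src.eval σ = X) (hpar : par₀.eval (σ.setVar r X) = p₀)
    (hF : ∀ τ v, F (τ.setVar i v) = F τ ∧ F (τ.setVar a v) = F τ ∧ F (τ.setVar r v) = F τ ∧
      F (τ.setVar par v) = F τ)
    (hbody : ∀ τ, Agree (bitLoop i a r par src par₀ body) σ τ → ∀ b ∈ bitSet X, τ.var a = b →
      τ.var par ≤ 1 → (-1 : ℤ) ^ τ.var par = (-1) ^ p₀ * rowSign (bitSet X) b →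
      Exec N body τ (fun υ => F υ = F τ + (-1) ^ τ.var par * g b)) :
    Exec N (bitLoop i a r par src par₀ body) σ (fun τ => F τ = F σ +
      (-1) ^ p₀ * ∑ b ∈ bitSet X, rowSign (bitSet X) b * g b) := by
  obtain ⟨hv1, hv2, hv3, hv4, hv5, hv6⟩ := hbv
  simp only [List.nodup_cons, List.mem_cons, List.not_mem_nil, or_false, not_or,
    ← ne_eq] at hne
  obtain ⟨⟨n1, n2, n3, n4⟩, ⟨n5, n6, n7⟩, ⟨n8, n9⟩, n10, -⟩ := hne
  set L := bitLoop i a r par src par₀ body with hL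
  refine .seq (.set (.seq (.set ?_)))
  rw [hsrc, hpar]
  set σ' := (σ.setVar r X).setVar par p₀ with hσ'
  have hwr : L.wv r = true := by simp [hL, bitLoop, Prog.wv]
  have hwa : L.wv a = true := by simp [hL, bitLoop, Prog.wv, Prog.forLoop]
  have hag : ∀ {τ}, Agree (.forLoop i (.var vM)
      (.seq (.set a (.sub (.var vM) (.add (.var i) (.lit 1))))
        (.ite (.le (.get aPow (.var a)) (.var r))
          (.seq (.set r (.sub (.var r) (.get aPow (.var a))))
            (.seq body (.set par (.sub (.lit 1) (.var par)))))
          .skip))) σ' τ → Agree L σ τ := fun h =>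
    ((Agree.setVar .rfl hwr).setVar (by simp [hL, bitLoop, Prog.wv])).trans h.seq_right.seq_right
  have hLm : L.wv vM = false := by
    simp [hL, bitLoop, Prog.wv, Prog.forLoop, hv5, n4, n7, n9, n10]
  have hLpow : L.wa aPow = false := by simp [hL, bitLoop, Prog.wa, Prog.forLoop, hv6]
  refine .forLoop (fun j τ => τ.var r = X % 2 ^ (m - j) ∧
    (τ.var par ≤ 1 ∧ (-1 : ℤ) ^ τ.var par =
      (-1) ^ (p₀ + ((bitSet X).filter (m - j ≤ ·)).card)) ∧
    F τ = F σ + (-1) ^ p₀ * ∑ b ∈ (bitSet X).filter (m - j ≤ ·), rowSign (bitSet X) b * g b) hN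
    ?_ ?_ ?_ ?_ ?_ ?_
  · simp [Prog.wv, hv1, Ne.symm n1, Ne.symm n2, Ne.symm n3]
  · intro τ h
    simpa [hm] using (hag h).var vM hLm
  · intro j τ v h
    simpa [n2.symm, n3.symm, (hF τ v).1] using h
  · have hempty : (bitSet X).filter (m - 0 ≤ ·) = ∅ := by
      ext x
      simp only [Nat.sub_zero, Finset.mem_filter, Finset.notMem_empty, iff_false, not_and]
      intro hx
      have := lt_of_mem_bitSet hX hx
      omega
    rw [hempty]
    have h1 : F σ' = F σ := by rw [hσ', (hF _ _).2.2.2, (hF _ _).2.2.1]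
    rw [h1]
    simp [hσ', n8, Nat.mod_eq_of_lt hX, hp₀]
  · intro j hj τ hτ hij ⟨inv1, ⟨inv2, inv2'⟩, inv3⟩
    have hag' := hag hτ
    have hτm : τ.var vM = m := (hag'.var vM hLm).trans hm
    set b := m - (j + 1) with hb
    have hbm : b < m := by omega
    have hb1 : m - j = b + 1 := by omega
    rw [hb1] at inv1 inv2' inv3
    have hτpow : τ.arr aPow b = 2 ^ b := by rw [hag'.arr _ hLpow, hpow b hbm]
    refine .seq (.set (.ite (fun hc => ?_) (fun hc => ?_)))
    -- The word `r` holds `X % 2 ^ (b + 1)`, which reaches `2 ^ b` exactly when `b` is a one.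
    · have hmem : b ∈ bitSet X := by
        by_contra hmem
        simp only [BExp.holds_le, NExp.eval, State.setVar_var, State.setVar_arr, if_true,
          if_neg n5.symm, hτm, hij, ← hb, hτpow, inv1,
          mod_two_pow_succ_of_notMem_bitSet hmem] at hc
        exact absurd (Nat.mod_lt X (show 0 < 2 ^ b by positivity)) (by omega)
      have hins := filter_le_eq_insert hmem
      have hnot : b ∉ (bitSet X).filter (b + 1 ≤ ·) := by simp
      refine .seq (.set (.seq' (hbody _ ((hag'.setVar hwa).setVar hwr) b hmem ?_ ?_ ?_) ?_))
      · simp [n5, hτm, hij, hb]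
      · simpa [n6.symm, n8.symm] using inv2
      · simp only [State.setVar_var, if_neg n6.symm, if_neg n8.symm, inv2']
        rw [pow_add]
        rfl
      · intro υ hυ hFυ
        refine .set ⟨?_, ⟨?_, ?_⟩, ?_⟩
        · simp only [State.setVar_var, if_neg n8, NExp.eval, hυ.var r hv3]
          simp [n5.symm, hτm, hij, ← hb, hτpow, inv1, mod_two_pow_succ_of_mem_bitSet hmem]
        · simp
        · simp only [State.setVar_var, if_true, NExp.eval, hυ.var par hv4, if_neg n6.symm,
            if_neg n8.symm, hins, Finset.card_insert_of_notMem hnot]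
          rw [← add_assoc, pow_succ, ← inv2']
          interval_cases τ.var par <;> simp
        · rw [(hF _ _).2.2.2, hFυ, (hF _ _).2.2.1, (hF _ _).2.1, inv3, hins,
            Finset.sum_insert hnot]
          simp only [State.setVar_var, if_neg n6.symm, if_neg n8.symm, inv2']
          rw [pow_add]
          have : rowSign (bitSet X) b = (-1) ^ ((bitSet X).filter (b + 1 ≤ ·)).card := rfl
          rw [this]
          ring
    · have hmem : b ∉ bitSet X := by
        intro hmem
        refine hc ?_
        simp only [BExp.holds_le, NExp.eval, State.setVar_var, State.setVar_arr, if_true,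
          if_neg n5.symm, hτm, hij, ← hb, hτpow, inv1, mod_two_pow_succ_of_mem_bitSet hmem]
        omega
      refine .skip ⟨?_, ⟨?_, ?_⟩, ?_⟩
      · simp [n5.symm, inv1, mod_two_pow_succ_of_notMem_bitSet hmem]
      · simpa [n6.symm] using inv2
      · rw [filter_le_eq_of_notMem hmem]
        simpa [n6.symm] using inv2'
      · rw [(hF _ _).2.1, inv3, filter_le_eq_of_notMem hmem]
  · intro τ _ ⟨_, _, h⟩
    simpa using h

end RAM

/-! ### The recurrence for the sums over walks as a program. -/

namespace RAM

/-- The test whether there is a transition from the state `vPred` to the state `vQ`. -/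
def stepTest : BExp :=
  .or
    (.and (.eq (.get aJ (.var vQ)) (.get aJ (.var vPred)))
      (.and (.le (.lit 1) (.get aJ (.var vQ)))
        (.and (.eq (.get aPair (.var vQ)) (.get aPair (.var vPred)))
          (.and (.le (.lit 1)
              (.get aAdj (entry (.get aVert (.var vQ)) (.get aVert (.var vPred)))))
            (.qle
              (.add (.get qW (entry (.get aVert (.var vQ)) (.get aVert (.var vPred))))
                (.get qDist (entry (.get aVert (.var vPred)) (.get 2 (.get aPair (.var vQ))))))
              (.get qDist (entry (.get aVert (.var vQ)) (.get 2 (.get aPair (.var vQ))))))))))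
    (.and (.eq (.get aJ (.var vQ)) (.add (.get aJ (.var vPred)) (.lit 1)))
      (.and
        (.or (.le (.get aJ (.var vPred)) (.lit 0))
          (.eq (.get aVert (.var vPred)) (.get 1 (.get aPair (.var vPred)))))
        (.eq (.get aVert (.var vQ)) (.get 2 (.get aPair (.var vQ))))))

/-- Multiply the difference `vTPos - vTNeg` by the `(vA + vB)`-th power of the label of `vQ`. -/
def scale : Prog :=
  .forLoop 33 (.add (.var vA) (.var vB))
    (.seq (.set vUPos (.lit 0)) (.seq (.set vUNeg (.lit 0))
      (.seq (.forLoop 34 (.get aVert (.var vQ))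
          (.seq (.set vUPos (.add (.var vUPos) (.var vTPos)))
            (.set vUNeg (.add (.var vUNeg) (.var vTNeg)))))
        (.seq (.set vTPos (.var vUPos)) (.set vTNeg (.var vUNeg))))))

/-- Add the contributions of all predecessors of the state `vQ`, for one choice of rows. -/
def predLoop : Prog :=
  .forLoop vPred (.var vStates) (.ite stepTest
    (.seq (.set vIdx (.sub (.sub (.add (.get aBase (.var vPred)) (.var vZ))
          (.get aPow (.var vA))) (.get aPow (.add (.var vM) (.var vB)))))
      (.seq (.set vTPos (.get aPos (.var vIdx))) (.seq (.set vTNeg (.get aNeg (.var vIdx)))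
        (.seq scale (.ite (.le (.var vParA) (.lit 0))
          (.seq (.set vAccPos (.add (.var vAccPos) (.var vTPos)))
            (.set vAccNeg (.add (.var vAccNeg) (.var vTNeg))))
          (.seq (.set vAccPos (.add (.var vAccPos) (.var vTNeg)))
            (.set vAccNeg (.add (.var vAccNeg) (.var vTPos)))))))))
    .skip)

/-- Compute one entry of the table of sums over walks. -/
def cellValue : Prog :=
  .seq (.set vAccPos (.lit 0)) (.seq (.set vAccNeg (.lit 0))
    (.seq (.ite (.and (.le (.var vZ) (.lit 0)) (.le (.var vQ) (.lit 0)))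
        (.set vAccPos (.lit 1)) .skip)
      (bitLoop 24 vB 26 vParB (.var vY) (.lit 0)
        (bitLoop 28 vA 30 vParA (.var vX) (.var vParB) predLoop))))

/-- Compute one entry of the table of sums over walks, and store it. -/
def cell : Prog :=
  .seq cellValue
    (.seq (.put aPos (.add (.get aBase (.var vQ)) (.var vZ)) (.var vAccPos))
      (.put aNeg (.add (.get aBase (.var vQ)) (.var vZ)) (.var vAccNeg)))

/-- Fill the table of sums over walks. -/
def fill : Prog :=
  .seq (.set vZ (.lit 0))
    (.forLoop vY (.get aPow (.var vM)) (.forLoop vX (.get aPow (.var vM))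
      (.seq (.forLoop vQ (.var vStates) cell) (.set vZ (.add (.var vZ) (.lit 1))))))

/-- The memory contains the instance, the distances `d` and the state table. -/
structure HasStates (I : MVDSP) (Q : ℕ) (J A V : ℕ → ℕ) (d : ℕ → ℚ≥0) (σ : State) : Prop where
  input : HasInput I σ
  states : σ.var vStates = Q
  aJ_eq : σ.arr aJ = J
  aPair_eq : σ.arr aPair = A
  aVert_eq : σ.arr aVert = V
  dist : σ.qarr qDist = d

/-- The memory contains, in addition, the parameter `m` and the tables that depend on it. -/
structure HasTables (I : MVDSP) (Q : ℕ) (J A V : ℕ → ℕ) (d : ℕ → ℚ≥0) (m : ℕ) (σ : State) :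
    Prop extends HasStates I Q J A V d σ where
  m_eq : σ.var vM = m
  pow : ∀ a ≤ 2 * m, σ.arr aPow a = 2 ^ a
  base : ∀ q < Q, σ.arr aBase q = q * 2 ^ (2 * m)

/-- The program does not touch what `HasStates` speaks about. -/
def Prog.keepsStates (c : Prog) : Bool :=
  c.keepsInput && !c.wv 4 && !c.wa 5 && !c.wa 6 && !c.wa 7 && !c.wqa 1

/-- The program does not touch what `HasTables` speaks about. -/
def Prog.keepsTables (c : Prog) : Bool :=
  c.keepsStates && !c.wv 5 && !c.wa 8 && !c.wa 9

section
variable {I : MVDSP} {Q : ℕ} {J A V : ℕ → ℕ} {d : ℕ → ℚ≥0} {m N : ℕ} {σ : State}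

theorem HasStates.agree {τ : State} {c : Prog} (h : HasStates I Q J A V d σ)
    (hag : Agree c σ τ) (hc : c.keepsStates = true) : HasStates I Q J A V d τ := by
  simp only [Prog.keepsStates, Bool.and_eq_true, Bool.not_eq_true'] at hc
  obtain ⟨⟨⟨⟨⟨h1, h2⟩, h3⟩, h4⟩, h5⟩, h6⟩ := hc
  exact ⟨h.input.agree hag h1, (hag.var _ h2).trans h.states, (hag.arr _ h3).trans h.aJ_eq,
    (hag.arr _ h4).trans h.aPair_eq, (hag.arr _ h5).trans h.aVert_eq,
    (hag.qarr _ h6).trans h.dist⟩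

theorem HasTables.agree {τ : State} {c : Prog} (h : HasTables I Q J A V d m σ)
    (hag : Agree c σ τ) (hc : c.keepsTables = true) : HasTables I Q J A V d m τ := by
  simp only [Prog.keepsTables, Bool.and_eq_true, Bool.not_eq_true'] at hc
  obtain ⟨⟨⟨h1, h2⟩, h3⟩, h4⟩ := hc
  exact ⟨h.toHasStates.agree hag h1, (hag.var _ h2).trans h.m_eq,
    by rw [hag.arr _ h3]; exact h.pow, by rw [hag.arr _ h4]; exact h.base⟩

theorem holds_stepTest (hT : I.IsStateTable Q J A V) (hσ : HasStates I Q J A V d σ) {q q' : ℕ}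
    (hq : q < Q) (hq' : q' < Q) (h : σ.var vQ = q) (h' : σ.var vPred = q') :
    stepTest.Holds σ ↔ I.Step d J A V q' q := by
  simp only [stepTest, entry, BExp.holds_or, BExp.holds_and, BExp.holds_eq, BExp.holds_le,
    BExp.holds_qle, NExp.eval, QExp.eval, h, h', hσ.aJ_eq, hσ.aPair_eq, hσ.aVert_eq, hσ.dist,
    hσ.input.adj, hσ.input.s, hσ.input.t, hσ.input.w, MVDSP.Step, Nat.le_zero]
  refine or_congr ?_ Iff.rfl
  refine and_congr_right fun h1 => and_congr_right fun h2 => and_congr_right fun _ => ?_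
  -- The row table is known only for vertices, and the source need not carry one; the test `1 ≤ J q`
  -- excludes it.
  have hq0 : q ≠ 0 := by
    rintro rfl
    rw [hT.source] at h2
    omega
  have hq0' : q' ≠ 0 := by
    rintro rfl
    rw [h1, hT.source] at h2
    omega
  rw [hσ.input.row _ (hT.range q hq hq0).2.2, hσ.input.row _ (hT.range q' hq' hq0').2.2]

/-- A power by repeated multiplication, each multiplication by repeated addition. The numbers of
rounds are the exponent and the label, not the possibly huge values multiplied, so they stay below
`N`. -/
theorem exec_scale (hab : σ.var vA + σ.var vB ≤ N) (hv : σ.arr aVert (σ.var vQ) ≤ N) :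
    Exec N scale σ (fun τ =>
      τ.var vTPos = σ.var vTPos * σ.arr aVert (σ.var vQ) ^ (σ.var vA + σ.var vB) ∧
      τ.var vTNeg = σ.var vTNeg * σ.arr aVert (σ.var vQ) ^ (σ.var vA + σ.var vB)) := by
  refine .forLoop (fun i τ =>
      τ.var vTPos = σ.var vTPos * σ.arr aVert (σ.var vQ) ^ i ∧
      τ.var vTNeg = σ.var vTNeg * σ.arr aVert (σ.var vQ) ^ i) hab rfl ?_
    (fun _ _ _ h => h) (by simp) ?_ (fun _ _ h => h)
  · intro τ h
    simp [h.var vA (by decide), h.var vB (by decide)]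
  · intro i _ τ ag _ ⟨inv1, inv2⟩
    refine .seq (.set (.seq (.set (.seq' (Q' := fun υ =>
      υ.var vUPos = σ.arr aVert (σ.var vQ) * τ.var vTPos ∧
      υ.var vUNeg = σ.arr aVert (σ.var vQ) * τ.var vTNeg) ?_ ?_))))
    · refine .forLoop (fun j υ => υ.var vUPos = j * τ.var vTPos ∧ υ.var vUNeg = j * τ.var vTNeg)
        hv rfl ?_ (fun _ _ _ h => h) (by simp) ?_ (fun _ _ h => h)
      · intro υ h
        simp [h.var vQ (by decide), h.arr aVert (by decide), ag.var vQ (by decide),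
          ag.arr aVert (by decide)]
      · intro j _ υ h _ ⟨inv1, inv2⟩
        refine .seq (.set (.set ?_))
        have h1 : υ.var vTPos = τ.var vTPos := h.var vTPos (by decide)
        have h2 : υ.var vTNeg = τ.var vTNeg := h.var vTNeg (by decide)
        simp [inv1, inv2, h1, h2, Nat.succ_mul]
    · intro υ _ ⟨h1, h2⟩
      refine .seq (.set (.set ?_))
      simp only [State.setVar_var, NExp.eval, h1, h2, inv1, inv2]
      constructor
      · simp; ring
      · simp; ring

/-- The value of an entry of the table of sums over walks. -/
def tableValue (σ : State) (i : ℕ) : ℤ := (σ.arr aPos i : ℤ) - σ.arr aNeg i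

/-- The value of the accumulator. -/
def accValue (σ : State) : ℤ := (σ.var vAccPos : ℤ) - σ.var vAccNeg

-- An integer is kept as a difference of two words, and a minus sign exchanges them. Subtracting `2
-- ^ a` and `2 ^ (m + b)` from the index erases `a` from the low half, which codes `X`, and `b` from
-- the high half, which codes `Y`.
open Classical in
theorem exec_predLoop (hT : I.IsStateTable Q J A V) (hσ : HasTables I Q J A V d m σ) {q a b z : ℕ}
    (hq : q < Q) (hQN : Q ≤ N) (hnN : I.n ≤ N) (hmN : 2 * m ≤ N) (ha : a < m) (hb : b < m)
    (hvq : σ.var vQ = q) (hva : σ.var vA = a) (hvb : σ.var vB = b) (hvz : σ.var vZ = z)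
    (hpar : σ.var vParA ≤ 1) :
    Exec N predLoop σ (fun τ => accValue τ = accValue σ + (-1) ^ σ.var vParA *
      ∑ q' ∈ Finset.range Q, if I.Step d J A V q' q then
        (V q : ℤ) ^ (a + b) * tableValue σ (q' * 2 ^ (2 * m) + z - 2 ^ a - 2 ^ (m + b)) else 0) := by
  refine .forLoop (fun i τ => accValue τ = accValue σ + (-1) ^ σ.var vParA *
      ∑ q' ∈ Finset.range i, if I.Step d J A V q' q then
        (V q : ℤ) ^ (a + b) * tableValue σ (q' * 2 ^ (2 * m) + z - 2 ^ a - 2 ^ (m + b)) else 0)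
    hQN rfl (fun τ h => by simpa using (hσ.agree h (by decide)).states) (fun _ _ _ h => h)
    (by simp) ?_ (fun _ _ h => h)
  intro i hi τ ag hvi inv
  have hτ := hσ.agree ag (by decide)
  have hvq' : τ.var vQ = q := (ag.var _ (by decide)).trans hvq
  have hva' : τ.var vA = a := (ag.var _ (by decide)).trans hva
  have hvb' : τ.var vB = b := (ag.var _ (by decide)).trans hvb
  have hvz' : τ.var vZ = z := (ag.var _ (by decide)).trans hvz
  have hpar' : τ.var vParA = σ.var vParA := ag.var _ (by decide)
  have hstep := holds_stepTest hT hτ.toHasStates hq hi hvq' hvi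
  refine .ite (fun hc => ?_) (fun hc => ?_)
  · rw [hstep] at hc
    -- No step enters the source, so `V q` is a vertex and bounds a loop of `scale`.
    have hq0 : q ≠ 0 := by
      rintro rfl
      rcases hc with ⟨-, h, -⟩ | ⟨h, -⟩ <;> rw [hT.source] at h <;> omega
    refine .seq (.set (.seq (.set (.seq (.set (.seq' (exec_scale ?_ ?_) ?_))))))
    · simp [hva', hvb']; omega
    · simp only [State.setVar_var, State.setVar_arr, hvq', hτ.aVert_eq]
      exact (hT.range q hq hq0).2.2.le.trans hnN
    · intro υ agυ ⟨h1, h2⟩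
      simp only [State.setVar_var, State.setVar_arr, NExp.eval, hva', hvb', hvz', hvi, hvq',
        hτ.aVert_eq, hτ.base i hi, hτ.pow a (by omega), hτ.m_eq, hτ.pow (m + b) (by omega),
        ag.arr aPos (by decide), ag.arr aNeg (by decide)] at h1 h2
      norm_num at h1 h2
      have hp : υ.var vParA = σ.var vParA := by
        rw [agυ.var _ (by decide)]; simpa using hpar'
      have hP : υ.var vAccPos = τ.var vAccPos := by rw [agυ.var _ (by decide)]; simp
      have hN' : υ.var vAccNeg = τ.var vAccNeg := by rw [agυ.var _ (by decide)]; simp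
      rw [Finset.sum_range_succ, if_pos hc, mul_add, ← add_assoc, ← inv]
      refine .ite (fun hc' => .seq (.set (.set ?_))) (fun hc' => .seq (.set (.set ?_)))
      · have h0 : σ.var vParA = 0 := by simpa [hp] using hc'
        simp [accValue, tableValue, h0, h1, h2, hP, hN']; ring
      · have h0 : σ.var vParA = 1 := by simp [hp] at hc'; omega
        simp [accValue, tableValue, h0, h1, h2, hP, hN']; ring
  · rw [hstep] at hc
    refine .skip ?_
    rw [Finset.sum_range_succ, if_neg hc, add_zero]
    exact inv

/-- The two nested bit loops evaluate the double sum in `walkSum_eq`; the parity of the outer loop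
starts the inner one, so the two row signs multiply. Erasing lowers both codes, hence `hprev` asks
only for `X' < X` and `Y' < Y`. -/
theorem exec_cellValue (hT : I.IsStateTable Q J A V) (hσ : HasTables I Q J A V d m σ) {q X Y : ℕ}
    (hq : q < Q) (hQN : Q ≤ N) (hnN : I.n ≤ N) (hmN : 2 * m ≤ N) (hX : X < 2 ^ m) (hY : Y < 2 ^ m)
    (hvq : σ.var vQ = q) (hvX : σ.var vX = X) (hvY : σ.var vY = Y)
    (hvz : σ.var vZ = Y * 2 ^ m + X)
    (hprev : ∀ q' < Q, ∀ X' < X, ∀ Y' < Y,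
      tableValue σ (q' * 2 ^ (2 * m) + (Y' * 2 ^ m + X')) =
        walkSum Q (I.Step d J A V) V (bitSet X') (bitSet Y') q') :
    Exec N cellValue σ (fun τ => accValue τ =
      walkSum Q (I.Step d J A V) V (bitSet X) (bitSet Y) q) := by
  have htv : ∀ {σ τ c}, Agree c σ τ → c.wa aPos = false → c.wa aNeg = false →
      tableValue τ = tableValue σ := fun h h1 h2 => by
    funext i; rw [tableValue, tableValue, h.arr _ h1, h.arr _ h2]
  refine .seq (.set (.seq (.set (.seq' (Q' := fun τ => accValue τ =
    if bitSet X = ∅ ∧ bitSet Y = ∅ ∧ q = 0 then 1 else 0) ?_ ?_))))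
  · have hz : Y * 2 ^ m + X = 0 ↔ X = 0 ∧ Y = 0 := by
      have : 0 < 2 ^ m := by positivity
      constructor
      · intro h
        have h1 : Y * 2 ^ m = 0 := by omega
        exact ⟨by omega, by simpa using h1⟩
      · rintro ⟨rfl, rfl⟩; simp
    refine .ite (fun hc => .set ?_) (fun hc => .skip ?_)
    · simp only [BExp.holds_and, BExp.holds_le, NExp.eval, State.setVar_var, Nat.le_zero, hvz, hvq]
        at hc
      norm_num [hz] at hc
      simp [accValue, bitSet_eq_empty_iff, hc]
    · simp only [BExp.holds_and, BExp.holds_le, NExp.eval, State.setVar_var, Nat.le_zero, hvz, hvq]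
        at hc
      norm_num [hz] at hc
      rw [if_neg (by rw [bitSet_eq_empty_iff, bitSet_eq_empty_iff]; tauto)]
      simp [accValue]
  intro τ agτ hacc
  have ag : Agree cellValue σ τ := ((Agree.rfl.setVar (by decide)).setVar (by decide)).trans
    agτ.seq_left.seq_right.seq_right
  have hτ := hσ.agree ag (by decide)
  classical
  refine (exec_bitLoop (m := m) (X := Y) (p₀ := 0) accValue (fun b => ∑ a ∈ bitSet X,
    rowSign (bitSet X) a * ∑ q' ∈ Finset.range Q, if I.Step d J A V q' q then
      (V q : ℤ) ^ (a + b) * walkSum Q (I.Step d J A V) V ((bitSet X).erase a) ((bitSet Y).erase b) q'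
      else 0) (by omega) hY (by omega) (by decide) (by decide) hτ.m_eq
    (fun a ha => hτ.pow a (by omega)) ?_ rfl
    (fun _ _ => ⟨rfl, rfl, rfl, rfl⟩) ?_).mono ?_
  · exact (ag.var vY (by decide)).trans hvY
  · intro τ₁ ag₁ b hb hvb hpb hsb
    have hbm := lt_of_mem_bitSet hY hb
    have hτ₁ := hτ.agree ag₁ (by decide)
    refine exec_bitLoop (m := m) (X := X) (p₀ := τ₁.var vParB) accValue _ (by omega) hX hpb
      (by decide) (by decide) hτ₁.m_eq (fun a ha => hτ₁.pow a (by omega))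
      ?_ (by simp) (fun _ _ => ⟨rfl, rfl, rfl, rfl⟩) ?_
    · exact (ag₁.var vX (by decide)).trans ((ag.var vX (by decide)).trans hvX)
    intro τ₂ ag₂ a ha hva hpa hsa
    have ham := lt_of_mem_bitSet hX ha
    have hτ₂ := hτ₁.agree ag₂ (by decide)
    refine (exec_predLoop hT hτ₂ hq hQN hnN hmN ham hbm ?_ hva
      ((ag₂.var _ (by decide)).trans hvb) (z := Y * 2 ^ m + X) ?_ hpa).mono fun υ _ hυ => ?_
    · rw [ag₂.var _ (by decide), ag₁.var _ (by decide), ag.var _ (by decide), hvq]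
    · rw [ag₂.var _ (by decide), ag₁.var _ (by decide), ag.var _ (by decide), hvz]
    · rw [hυ]
      congr 2
      refine Finset.sum_congr rfl fun q' hq' => ?_
      have hXa := two_pow_le_of_mem_bitSet ha
      have hYb := two_pow_le_of_mem_bitSet hb
      have hpa : 0 < 2 ^ a := by positivity
      have hpb : 0 < 2 ^ b := by positivity
      -- The subtracted powers occur in `X` and in `Y`, so nothing is borrowed across the blocks of
      -- the index.
      have hidx : q' * 2 ^ (2 * m) + (Y * 2 ^ m + X) - 2 ^ a - 2 ^ (m + b) =
          q' * 2 ^ (2 * m) + ((Y - 2 ^ b) * 2 ^ m + (X - 2 ^ a)) := by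
        have h1 : 2 ^ b * 2 ^ m ≤ Y * 2 ^ m := Nat.mul_le_mul_right _ hYb
        rw [Nat.sub_mul, pow_add, mul_comm (2 ^ m) (2 ^ b)]
        omega
      rw [hidx, htv ag₂ (by decide) (by decide), htv ag₁ (by decide) (by decide),
        htv ag (by decide) (by decide), hprev q' (Finset.mem_range.1 hq') _ (by omega) _ (by omega),
        bitSet_sub ha, bitSet_sub hb]
  · intro υ _ hυ
    rw [hυ, hacc, walkSum_eq, pow_zero, one_mul]

end

end RAM

/-! ### The program: the main loop -/

namespace RAM

/-- Fill `aPow` with the powers of two up to the exponent `2 * vM`. -/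
def powTable : Prog :=
  .seq (.put aPow (.lit 0) (.lit 1)) (.forLoop 14 (.add (.var vM) (.var vM))
    (.put aPow (.add (.var 14) (.lit 1))
      (.add (.get aPow (.var 14)) (.get aPow (.var 14)))))

/-- The test whether the state `vQ` is final. -/
def finalTest : BExp :=
  .and (.eq (.get aJ (.var vQ)) (.var vP))
    (.or (.le (.get aJ (.var vQ)) (.lit 0))
      (.eq (.get aVert (.var vQ)) (.get 1 (.get aPair (.var vQ)))))

/-- Set `vRes` if the sum over walks does not vanish for some final state. -/
def check : Prog :=
  .forLoop vQ (.var vStates) (.seq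
    (.set vIdx (.add (.get aBase (.var vQ))
      (.sub (.get aPow (.add (.var vM) (.var vM))) (.lit 1))))
    (.ite (.and finalTest (.not (.eq (.get aPos (.var vIdx)) (.get aNeg (.var vIdx)))))
      (.set vRes (.lit 1)) .skip))

/-- Decide whether there is a solution whose paths have `vM` vertices in total. -/
def round : Prog :=
  .seq powTable (.seq (mulTable aBase (.var vStates) (.get aPow (.add (.var vM) (.var vM))))
    (.seq fill check))

/-- The program. -/
def program : Prog :=
  .seq (.ite (.le (.var vP) (.var vN))
      (.seq distances (.seq states
        (.forLoop vM (.add (.var vN) (.lit 1)) (.ite (.le (.var vRes) (.lit 0)) round .skip))))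
      .skip)
    (.set 0 (.var vRes))

section
variable {I : MVDSP} {Q : ℕ} {J A V : ℕ → ℕ} {d : ℕ → ℚ≥0} {m N : ℕ} {σ : State}

theorem mul_add_inj {M a b c e : ℕ} (hb : b < M) (he : e < M) (h : a * M + b = c * M + e) :
    a = c ∧ b = e := by
  have hM : 0 < M := by omega
  have h1 := congrArg (· / M) h
  simp only [Nat.mul_comm _ M, Nat.mul_add_div hM, Nat.div_eq_of_lt hb, Nat.div_eq_of_lt he,
    add_zero] at h1
  subst h1
  exact ⟨rfl, by omega⟩

/-- The entries of the table of sums over walks that precede `(y, x, c)` are correct. -/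
def Filled (Q : ℕ) (R : ℕ → ℕ → Prop) (V : ℕ → ℕ) (m y x c : ℕ) (σ : State) : Prop :=
  ∀ Y < 2 ^ m, ∀ X < 2 ^ m, ∀ q < Q, (Y < y ∨ Y = y ∧ (X < x ∨ X = x ∧ q < c)) →
    tableValue σ (q * 2 ^ (2 * m) + (Y * 2 ^ m + X)) = walkSum Q R V (bitSet X) (bitSet Y) q

theorem exec_cell (hT : I.IsStateTable Q J A V) (hσ : HasTables I Q J A V d m σ) {q X Y : ℕ}
    (hq : q < Q) (hQN : Q ≤ N) (hnN : I.n ≤ N) (hmN : 2 * m ≤ N) (hX : X < 2 ^ m) (hY : Y < 2 ^ m)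
    (hvq : σ.var vQ = q) (hvX : σ.var vX = X) (hvY : σ.var vY = Y)
    (hvz : σ.var vZ = Y * 2 ^ m + X) (h : Filled Q (I.Step d J A V) V m Y X q σ) :
    Exec N cell σ (Filled Q (I.Step d J A V) V m Y X (q + 1)) := by
  refine .seq' (exec_cellValue hT hσ hq hQN hnN hmN hX hY hvq hvX hvY hvz
    fun q' hq' X' hX' Y' hY' => h Y' (by omega) X' (by omega) q' hq' (by omega)) ?_
  intro τ ag hacc
  have hτ := hσ.agree ag (by decide)
  have hvq' : τ.var vQ = q := (ag.var _ (by decide)).trans hvq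
  have hvz' : τ.var vZ = Y * 2 ^ m + X := (ag.var _ (by decide)).trans hvz
  refine .seq (.put (.put fun Y' hY' X' hX' q' hq' hlex => ?_))
  have hZ : ∀ {x y : ℕ}, x < 2 ^ m → y < 2 ^ m → y * 2 ^ m + x < 2 ^ (2 * m) := by
    intro x y hx hy
    rw [two_mul, pow_add]
    nlinarith
  by_cases he : Y' = Y ∧ X' = X ∧ q' = q
  · obtain ⟨rfl, rfl, rfl⟩ := he
    simp only [tableValue, State.setArr_arr, State.setArr_var, NExp.eval, hvq', hvz', hτ.base q' hq']
    simp [hτ.base q' hq', ← hacc, accValue]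
  · have hne : q' * 2 ^ (2 * m) + (Y' * 2 ^ m + X') ≠ q * 2 ^ (2 * m) + (Y * 2 ^ m + X) := by
      intro h'
      obtain ⟨h1, h2⟩ := mul_add_inj (hZ hX' hY') (hZ hX hY) h'
      obtain ⟨h3, h4⟩ := mul_add_inj hX' hX h2
      exact he ⟨h3, h4, h1⟩
    rw [← h Y' hY' X' hX' q' hq' (by omega)]
    simp only [tableValue, State.setArr_arr, State.setArr_var, NExp.eval, hvq', hvz', hτ.base q hq]
    simp [hτ.base q hq, hne, ag.arr aPos (by decide), ag.arr aNeg (by decide)]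

/-- In numerical order of `(Y, X)` every entry needed is ready when it is read, so leftovers from
smaller `m` do no harm. The running index `vZ` equals `Y * 2 ^ m + X` without a multiplication. -/
theorem exec_fill (hT : I.IsStateTable Q J A V) (hσ : HasTables I Q J A V d m σ)
    (hQN : Q ≤ N) (hnN : I.n ≤ N) (hmN : 2 * m ≤ N) (hpN : 2 ^ m ≤ N) :
    Exec N fill σ (Filled Q (I.Step d J A V) V m (2 ^ m) 0 0) := by
  have hM : ∀ {τ}, HasTables I Q J A V d m τ → (NExp.get aPow (.var vM)).eval τ = 2 ^ m :=
    fun h => by simp [h.m_eq, h.pow m (by omega)]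
  refine .seq (.set ?_)
  have hσ' : HasTables I Q J A V d m (σ.setVar vZ ((NExp.lit 0).eval σ)) :=
    hσ.agree (c := fill) (Agree.rfl.setVar (by decide)) (by decide)
  refine .forLoop (fun y τ => τ.var vZ = y * 2 ^ m ∧ Filled Q (I.Step d J A V) V m y 0 0 τ) hpN rfl
    (fun τ h => hM (hσ'.agree h (by decide))) (fun _ _ _ h => h)
    ⟨by simp, fun _ _ _ _ _ _ h => by omega⟩ ?_ (fun _ _ h => h.2)
  intro y hy τ₁ ag₁ hy₁ ⟨hz₁, inv₁⟩
  have hτ₁ := hσ'.agree ag₁ (by decide)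
  refine .forLoop (fun x τ => τ.var vZ = y * 2 ^ m + x ∧
      Filled Q (I.Step d J A V) V m y x 0 τ) hpN rfl
    (fun τ h => hM (hτ₁.agree h (by decide))) (fun _ _ _ h => h) ⟨hz₁, inv₁⟩ ?_
    (fun _ _ h => ⟨by rw [h.1]; ring, fun Y hY X hX q hq hlex =>
      h.2 Y hY X hX q hq (by omega)⟩)
  intro x hx τ₂ ag₂ hx₂ ⟨hz₂, inv₂⟩
  have hτ₂ := hτ₁.agree ag₂ (by decide)
  have hy₂ : τ₂.var vY = y := (ag₂.var _ (by decide)).trans hy₁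
  refine .seq' (Q' := fun τ => Filled Q (I.Step d J A V) V m y x Q τ) ?_ ?_
  · refine .forLoop (fun c τ => Filled Q (I.Step d J A V) V m y x c τ) hQN rfl
      (fun τ h => by simpa using (hτ₂.agree h (by decide)).states) (fun _ _ _ h => h) inv₂ ?_
      (fun _ _ h => h)
    intro c hc τ₃ ag₃ hc₃ inv₃
    exact exec_cell hT (hτ₂.agree ag₃ (by decide)) hc hQN hnN hmN hx hy hc₃
      ((ag₃.var _ (by decide)).trans hx₂) ((ag₃.var _ (by decide)).trans hy₂)
      ((ag₃.var _ (by decide)).trans hz₂) inv₃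
  · intro υ ag h
    refine .set ⟨?_, fun Y hY X hX q hq hlex => h Y hY X hX q hq (by omega)⟩
    simp [ag.var vZ (by decide), hz₂, add_assoc]

/-- Walks that correspond to solutions and have `m` steps. -/
def GoodState (I : MVDSP) (Q : ℕ) (J A V : ℕ → ℕ) (d : ℕ → ℚ≥0) (m q : ℕ) : Prop :=
  I.Final J A V q ∧ ∃ l ∈ walkLabels Q (I.Step d J A V) V m q, l.Nodup

theorem exec_check (hσ : HasTables I Q J A V d m σ) (hQN : Q ≤ N) (hres : σ.var vRes = 0)
    (h : Filled Q (I.Step d J A V) V m (2 ^ m) 0 0 σ) :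
    Exec N check σ (fun τ => τ.var vRes = 1 ∧ (∃ q < Q, GoodState I Q J A V d m q) ∨
      τ.var vRes = 0 ∧ ∀ q < Q, ¬ GoodState I Q J A V d m q) := by
  refine .forLoop (fun i τ => τ.var vRes = 1 ∧ (∃ q < Q, GoodState I Q J A V d m q) ∨
      τ.var vRes = 0 ∧ ∀ q < i, ¬ GoodState I Q J A V d m q) hQN rfl
    (fun τ h => by simpa using (hσ.agree h (by decide)).states) (fun _ _ _ h => h)
    (.inr ⟨hres, by omega⟩) ?_ (fun _ _ h => h)
  intro i hi τ ag hvi inv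
  have hτ := hσ.agree ag (by decide)
  have hpos : 0 < 2 ^ m := by positivity
  -- The last index of a block codes `X = Y = Finset.range m`, where the sum is one of squares.
  have hval : tableValue σ (i * 2 ^ (2 * m) + (2 ^ (2 * m) - 1)) ≠ 0 ↔
      ∃ l ∈ walkLabels Q (I.Step d J A V) V m i, l.Nodup := by
    rw [← walkSum_range_ne_zero_iff, ← bitSet_two_pow_sub_one,
      ← h (2 ^ m - 1) (by omega) (2 ^ m - 1) (by omega) i hi (by omega)]
    have : (2 ^ m - 1) * 2 ^ m + (2 ^ m - 1) = 2 ^ (2 * m) - 1 := by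
      have h1 : 2 ^ m ≤ 2 ^ m * 2 ^ m := Nat.le_mul_of_pos_right _ hpos
      rw [Nat.sub_mul, one_mul, two_mul, pow_add]
      omega
    rw [this]
  refine .seq (.set ?_)
  have htest : (BExp.and finalTest
      (.not (.eq (.get aPos (.var vIdx)) (.get aNeg (.var vIdx))))).Holds
      (τ.setVar vIdx ((NExp.add (.get aBase (.var vQ))
        (.sub (.get aPow (.add (.var vM) (.var vM))) (.lit 1))).eval τ)) ↔
      GoodState I Q J A V d m i := by
    rw [GoodState, ← hval]
    simp only [finalTest, BExp.holds_and, BExp.holds_eq, BExp.holds_or, BExp.holds_le,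
      BExp.holds_not, NExp.eval, State.setVar_var, State.setVar_arr, hvi, hτ.aJ_eq, hτ.aPair_eq,
      hτ.aVert_eq, hτ.input.p, hτ.input.s, hτ.base i hi, hτ.m_eq, ← two_mul,
      hτ.pow (2 * m) le_rfl, Nat.le_zero, MVDSP.Final, tableValue,
      ag.arr aPos (by decide), ag.arr aNeg (by decide)]
    simp [sub_eq_zero]
  refine .ite (fun hc => .set (.inl ⟨by simp, i, hi, htest.1 hc⟩)) (fun hc => .skip ?_)
  rcases inv with inv | ⟨inv1, inv2⟩
  · exact .inl inv
  · refine .inr ⟨inv1, fun q hq => ?_⟩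
    rcases Nat.lt_succ_iff_lt_or_eq.1 hq with hq | rfl
    · exact inv2 q hq
    · exact fun h' => hc (htest.2 h')

theorem exec_powTable (hm : σ.var vM = m) (hmN : 2 * m ≤ N) :
    Exec N powTable σ (fun τ => ∀ a ≤ 2 * m, τ.arr aPow a = 2 ^ a) := by
  refine .seq (.put (.forLoop (fun i τ => ∀ a ≤ i, τ.arr aPow a = 2 ^ a) hmN rfl ?_
    (fun _ _ _ h => h) ?_ ?_ (fun _ _ h => h)))
  · intro τ h
    have : τ.var vM = m := (h.var vM (by decide)).trans hm
    simp [this, two_mul]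
  · intro a ha
    obtain rfl : a = 0 := by omega
    simp
  · intro i _ τ _ hi inv
    refine .put fun a ha => ?_
    rcases Nat.le_succ_iff.1 ha with ha | rfl
    · have : a ≠ i + 1 := by omega
      simp [hi, this, inv a ha]
    · simp [hi, inv i le_rfl, pow_succ]; ring

theorem exec_round (hT : I.IsStateTable Q J A V) (hσ : HasStates I Q J A V d σ)
    (hm : σ.var vM = m) (hres : σ.var vRes = 0)
    (hQN : Q ≤ N) (hnN : I.n ≤ N) (hmN : 2 * m ≤ N) (hpN : 2 ^ m ≤ N) :
    Exec N round σ (fun τ => τ.var vRes = 1 ∧ (∃ q < Q, GoodState I Q J A V d m q) ∨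
      τ.var vRes = 0 ∧ ∀ q < Q, ¬ GoodState I Q J A V d m q) := by
  refine .seq' (exec_powTable hm hmN) fun τ₁ ag₁ hpow => ?_
  have hτ₁ := hσ.agree ag₁ (by decide)
  have hm₁ : τ₁.var vM = m := (ag₁.var _ (by decide)).trans hm
  refine .seq' (exec_mulTable (M := Q) (E := 2 ^ (2 * m)) hQN (fun τ h => ?_) fun τ h => ?_)
    fun τ₂ ag₂ hbase => ?_
  · simpa using (hτ₁.agree h (by decide)).states
  · have : τ.var vM = m := (h.var _ (by decide)).trans hm₁
    simp [this, ← two_mul, h.arr aPow (by decide), hpow (2 * m) le_rfl]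
  have hτ₂ : HasTables I Q J A V d m τ₂ := ⟨hτ₁.agree ag₂ (by decide),
    (ag₂.var _ (by decide)).trans hm₁, by rw [ag₂.arr _ (by decide)]; exact hpow, hbase⟩
  refine .seq' (exec_fill hT hτ₂ hQN hnN hmN hpN) fun τ₃ ag₃ hfill => ?_
  refine exec_check (hτ₂.agree ag₃ (by decide)) hQN ?_ hfill
  rw [ag₃.var _ (by decide), ag₂.var _ (by decide), ag₁.var _ (by decide), hres]

end

/-- Disjoint paths have distinct starts. Thus `p > n` can be rejected at once, and `p` does not
enter the running time. -/
theorem card_le_of_isYes {I : MVDSP} (h : I.IsYes) : I.p ≤ I.n := by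
  obtain ⟨S, P, h1, h2, h3⟩ := h
  have hinj : Set.InjOn I.s S := by
    intro i hi j hj hij
    by_contra hne
    obtain ⟨l, hl⟩ := (h2 i hi).1.exists_eq_cons
    obtain ⟨l', hl'⟩ := (h2 j hj).1.exists_eq_cons
    exact h3 i hi j hj hne (by rw [hl]; simp) (by rw [hl', ← hij]; simp : I.s i ∈ P j)
  rw [← Finset.card_image_of_injOn hinj] at h1
  exact h1.trans ((Finset.card_le_univ _).trans (by simp))

/-- A bound for the number of rounds of the loops. -/
def roundBound (ℓ s : ℕ) : ℕ := 2 ^ (2 * ℓ) * s ^ 3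

/-- A full round for `m` is carried out only after all smaller values have failed, which forces `m ≤
2ℓ`; this keeps the loops with `2 ^ m` rounds below `N`. -/
theorem exec_program (I : MVDSP) :
    Exec (roundBound I.ell (I.n + I.k + 1)) program I.input
      (fun τ => (I.IsYes → τ.var 0 = 1) ∧ (¬ I.IsYes → τ.var 0 = 0)) := by
  set N := roundBound I.ell (I.n + I.k + 1) with hN
  have hN3 : (I.n + I.k + 1) ^ 3 ≤ N := Nat.le_mul_of_pos_left _ (by positivity)
  have hn2 : 2 * I.n + 1 ≤ N := le_trans (by ring_nf; nlinarith) hN3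
  have hk : I.k ≤ N := le_trans (by ring_nf; nlinarith) hN3
  have hpow : ∀ m ≤ 2 * I.ell, 2 ^ m ≤ N := fun m hm =>
    (Nat.pow_le_pow_right (by norm_num) hm).trans (Nat.le_mul_of_pos_right _ (by positivity))
  have hin0 : I.input.var vN = I.n := by simp [MVDSP.input]
  have hin2 : I.input.var vP = I.p := by simp [MVDSP.input]
  have hin3 : I.input.var vRes = 0 := by simp [MVDSP.input]
  refine .seq' (Q' := fun τ => (I.IsYes → τ.var vRes = 1) ∧ (¬ I.IsYes → τ.var vRes = 0))
    (.ite (fun hc => ?_) (fun hc => .skip ⟨fun h => absurd (card_le_of_isYes h) ?_, fun _ => hin3⟩))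
    (fun τ _ h => .set (by simpa using h))
  swap
  · simpa [hin0, hin2] using hc
  have hp : I.p ≤ I.n := by simpa [hin0, hin2] using hc
  refine .seq' (exec_distances (by omega)) fun τ₁ ag₁ ⟨hI₁, hd₁⟩ => ?_
  refine .seq' (exec_states (by omega) hk (by omega) hI₁ ?_) fun τ₂ ag₂ ⟨hQ, hT⟩ => ?_
  · rw [ag₁.arr aJ (by decide)]; simp [MVDSP.input]
  have hd : I.IsDist (τ₂.qarr qDist) := by rw [ag₂.qarr _ (by decide)]; exact hd₁
  have hτ₂ : HasStates I (τ₂.var vStates) (τ₂.arr aJ) (τ₂.arr aPair) (τ₂.arr aVert)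
      (τ₂.qarr qDist) τ₂ := ⟨hI₁.agree ag₂ (by decide), rfl, rfl, rfl, rfl, rfl⟩
  have hres₂ : τ₂.var vRes = 0 := by rw [ag₂.var _ (by decide), ag₁.var _ (by decide), hin3]
  generalize τ₂.var vStates = Q at hQ hT hτ₂
  generalize τ₂.arr aJ = J at hT hτ₂
  generalize τ₂.arr aPair = A at hT hτ₂
  generalize τ₂.arr aVert = V at hT hτ₂
  generalize τ₂.qarr qDist = d at hd hτ₂
  -- There are `1 + p * k * n` states, and `p ≤ n` makes this at most the cube in `roundBound`.
  have hQN : Q ≤ N := by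
    refine le_trans ?_ hN3
    rw [hQ]
    have : I.p * I.k * I.n ≤ I.n * I.k * I.n := by gcongr
    ring_nf at this ⊢
    nlinarith
  refine .forLoop (M := I.n + 1) (fun i τ => τ.var vRes = 1 ∧ I.IsYes ∨
      τ.var vRes = 0 ∧ ∀ m < i, ∀ q < Q, ¬ GoodState I Q J A V d m q) (by omega) rfl
    (fun τ h => by simpa using (hτ₂.agree h (by decide)).input.n) (fun _ _ _ h => h)
    (.inr ⟨hres₂, by omega⟩) ?_ ?_
  · intro m hm τ ag hvm inv
    have hτ := hτ₂.agree ag (by decide)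
    refine .ite (fun hc => ?_) (fun hc => .skip (.inl (inv.resolve_right fun h => hc ?_)))
    swap
    · simp [h.1]
    have hc : τ.var vRes = 0 := by simpa using hc
    have hno := (inv.resolve_left (by omega)).2
    -- In a yes-instance some `m' ≤ 2ℓ` succeeds, and no value below `m` did; in a no-instance `ℓ =
    -- n`.
    have hmell : m ≤ 2 * I.ell := by
      by_cases hy : I.IsYes
      · obtain ⟨m', -, h1, q, hq, h2, h3⟩ := hy.exists_walk hT hd
        by_contra hlt
        exact hno m' (by omega) q hq ⟨h2, h3⟩
      · rw [MVDSP.ell, if_neg hy]; omega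
    refine (exec_round hT hτ hvm hc hQN (by omega) (by omega) (hpow m hmell)).mono fun υ _ h => ?_
    rcases h with ⟨h, q, hq, hf, l, hl, hl'⟩ | ⟨h, h'⟩
    · exact .inl ⟨h, MVDSP.isYes_of_walk hT hd hq hl hl' hf⟩
    · refine .inr ⟨h, fun m' hm' => ?_⟩
      rcases Nat.lt_succ_iff_lt_or_eq.1 hm' with hm' | rfl
      · exact hno m' hm'
      · exact h'
  · intro τ _ inv
    rcases inv with ⟨h, hy⟩ | ⟨h, hno⟩
    · exact ⟨fun _ => h, fun h' => absurd hy h'⟩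
    · refine ⟨fun hy => ?_, fun _ => h⟩
      obtain ⟨m', h1, -, q, hq, h2, h3⟩ := hy.exists_walk hT hd
      exact absurd ⟨h2, h3⟩ (hno m' (by omega) q hq)

end RAM

/-- Maximum Vertex-Disjoint Shortest Paths on weighted directed graphs is decided by one
deterministic program in `2 ^ O(ℓ) * poly(n)` steps. If the list of terminal pairs has repetitions,
its length `k`, which then is not bounded in terms of `n`, counts towards the input size. -/
theorem theorem4 :
    ∃ (c : RAM.Prog) (C : ℕ), ∀ I : MVDSP,
      I.DecidedBy c (C * 2 ^ (C * I.ell) * (I.n + I.k + 1) ^ C) ∧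
      (Function.Injective (fun i => (I.s i, I.t i)) →
        I.DecidedBy c (C * 2 ^ (C * I.ell) * (I.n + 1) ^ C)) := by
  obtain ⟨D, hD⟩ := RAM.program.exists_bound_le
  -- Here `s = n + k + 1`, while `r` is `s` itself or, for distinct pairs, `n + 1`: then `k ≤ n ^ 2`
  -- gives `s ≤ r ^ 2`. The `D`-th power of `2 * 2 ^ (2ℓ) * r ^ 6` produces `2 ^ D` and the
  -- exponents `2 * D * ℓ` and `6 * D`, all absorbed by `D * 2 ^ D + 6 * D`.
  have key : ∀ ℓ s r : ℕ, 1 ≤ r → s ≤ r ^ 2 → 1 ≤ s →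
      RAM.program.bound (RAM.roundBound ℓ s) ≤
        (D * 2 ^ D + 6 * D) * 2 ^ ((D * 2 ^ D + 6 * D) * ℓ) * r ^ (D * 2 ^ D + 6 * D) := by
    intro ℓ s r hr hsr hs
    have hpos : 1 ≤ RAM.roundBound ℓ s := Nat.mul_pos (by positivity) (by positivity)
    calc RAM.program.bound (RAM.roundBound ℓ s)
        ≤ D * (RAM.roundBound ℓ s + 1) ^ D := hD _
      _ ≤ D * (2 * (2 ^ (2 * ℓ) * (r ^ 2) ^ 3)) ^ D := by
          gcongr
          calc RAM.roundBound ℓ s + 1 ≤ 2 * RAM.roundBound ℓ s := by omega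
            _ ≤ _ := by unfold RAM.roundBound; gcongr
      _ = D * 2 ^ D * 2 ^ (2 * D * ℓ) * r ^ (6 * D) := by
          rw [mul_pow, mul_pow, ← pow_mul, ← pow_mul, ← pow_mul]
          ring_nf
      _ ≤ _ := by
          gcongr
          · omega
          · norm_num
          · omega
          · omega
  refine ⟨RAM.program, D * 2 ^ D + 6 * D, fun I => ?_⟩
  obtain ⟨T, τ, h1, h2, h3⟩ := RAM.exec_program I
  refine ⟨⟨T, τ, h1, h2.trans (key _ _ _ (by omega) (by nlinarith) (by omega)), h3⟩,
    fun hinj => ⟨T, τ, h1, h2.trans (key _ _ _ (by omega) ?_ (by omega)), h3⟩⟩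
  have : I.k ≤ I.n * I.n := by simpa using Fintype.card_le_of_injective _ hinj
  nlinarith
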